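/- Let $N\in\mathbb N$ and $\Delta t>0$. For $n\ge 0$ let $p^n(x)=(2\pi\Delta t)^{-n/2}e^{-|x|^2/(2\Delta t)}$ and let $\mu^n(dx)=p^n(x)\,dx$ be the Gaussian measure $N(0,\Delta t I)$ on $\mathbb R^n$. On $\mathbb R^N$ write $\Delta W_1,\dots,\Delta W_N$ for the coordinate maps and $\mathcal G_k=\sigma(\Delta W_1,\dots,\Delta W_k)$; functions of $(\Delta W_1,\dots,\Delta W_k)$ are identified with functions on $\mathbb R^k$. Let $$H_m(x)=\frac{(-1)^m}{\sqrt{m!}}\,e^{x^2/2}\frac{d^m}{dx^m}e^{-x^2/2}.$$ A generalized functional on $\mathbb R^n$ is a linear functional $\varphi\mapsto\langle X,\varphi\rangle$ on the test functions $\varphi\in (p^n)^{1/2}\mathcal S(\mathbb R^n)\subset\mathcal S(\mathbb R^n)$ such that $f\mapsto\langle X,(p^n)^{1/2}f\rangle$ is a tempered distribution, i.e. $X(p^n)^{1/2}\in\mathcal S'(\mathbb R^n)$. Tempered distributions (by restriction) and elements $X\in L^2(\mu^n)$ (by $\langle X,\varphi\rangle=\int X\varphi\,dx$) are generalized functionals.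 Derivatives are defined by $\langle\partial_kX,\varphi\rangle=-\langle X,\partial_k\varphi\rangle$. For a generalized functional $X$ on $\mathbb R^N$ and $0\le k\le N$, the conditional expectation $Y=\mathbf E[X\mid\mathcal G_k]$ is the generalized functional $Y$ on $\mathbb R^k$ with $$\langle X, Zp^N\rangle=\langle Y,Zp^k\rangle\qquad\text{for all }Z\in\mathcal S(\mathbb R^k),$$ where on the left $Z$ is regarded as the function $Z(x_1,\dots,x_k)$ on $\mathbb R^N$. **Theorem.** Let $X\in L^2(\mu^N)$ be real-valued. For all $m\ge1$ and $1\le l\le N$ the generalized conditional expectation $\mathbf E[\partial_l^mX\mid\mathcal G_{l-1}]$ exists, is unique, and is given by an element of $L^2(\mu^{l-1})$; the products $\mathbf E[\partial_l^mX\mid\mathcal G_{l-1}]\,H_m(\Delta W_l/\sqrt{\Delta t})$ belong to $L^2(\mu^N)$, and $$X-E[X]=\sum_{m=1}^\infty\sum_{l=1}^N\frac{(\Delta t)^{m/2}}{\sqrt{m!}}\,\mathbf E[\partial_l^mX\mid\mathcal G_{l-1}]\,H_m\!\left(\frac{\Delta W_l}{\sqrt{\Delta t}}\right),$$ where the series over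 $m$ converges in $L^2(\mu^N)$ (unconditionally). -/

import Mathlib

open MeasureTheory SchwartzMap LineDeriv

noncomputable section

namespace DiscreteWiener

/-- The density `p^n(x) = (2πΔt)^(-n/2) exp(-|x|²/(2Δt))` of `N(0, Δt I)` on `ℝⁿ`. -/
def density (n : ℕ) (Δt : ℝ) (x : Fin n → ℝ) : ℝ :=
  (2 * Real.pi * Δt) ^ (-(n : ℝ) / 2) * Real.exp (-(∑ i, x i ^ 2) / (2 * Δt))

/-- The Gaussian measure `μ^n(dx) = p^n(x) dx` on `ℝⁿ`. The coordinate maps are the increments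
`ΔW_1, …, ΔW_n` of the random walk, so `L²(𝒢_n)` is `L²(μ^n)`. -/
def gaussianMeasure (n : ℕ) (Δt : ℝ) : Measure (Fin n → ℝ) :=
  volume.withDensity fun x => ENNReal.ofReal (density n Δt x)

/-- The normalized Hermite function
`H_m(x) = (-1)^m / √(m!) * exp(x²/2) * (d/dx)^m exp(-x²/2)`. -/
def hermiteH (m : ℕ) (x : ℝ) : ℝ :=
  (-1) ^ m / Real.sqrt (m.factorial : ℝ) * Real.exp (x ^ 2 / 2) *
    iteratedDeriv m (fun y : ℝ => Real.exp (-y ^ 2 / 2)) x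

/-- The projection `ℝⁿ → ℝᵏ` onto the first `k` coordinates, `(ΔW_1, …, ΔW_k)`. -/
def firstCoords {k n : ℕ} (h : k ≤ n) (x : Fin n → ℝ) : Fin k → ℝ :=
  fun i => x (Fin.castLE h i)

/-! ### Gaussian functions are Schwartz functions -/

theorem exists_bound_pow_mul_exp {c : ℝ} (hc : 0 < c) (M : ℕ) :
    ∃ C : ℝ, ∀ t : ℝ, 0 ≤ t → (1 + t) ^ M * Real.exp (-(c * t ^ 2)) ≤ C := by
  refine ⟨2 ^ M * (M.factorial / c ^ M) * Real.exp c, fun t ht => ?_⟩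
  have h1 : (1 + t) ^ M ≤ 2 ^ M * (1 + t ^ 2) ^ M := by
    rw [← mul_pow]
    refine pow_le_pow_left₀ (by positivity) ?_ M
    nlinarith [sq_nonneg (t - 1), sq_nonneg t]
  have h2 : (1 + t ^ 2) ^ M ≤ M.factorial / c ^ M * Real.exp (c * (1 + t ^ 2)) := by
    have := Real.pow_div_factorial_le_exp (c * (1 + t ^ 2)) (by positivity) M
    rw [mul_pow, div_le_iff₀ (by positivity)] at this
    rw [div_mul_eq_mul_div, le_div_iff₀ (by positivity)]
    linarith
  calc (1 + t) ^ M * Real.exp (-(c * t ^ 2))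
      ≤ 2 ^ M * (M.factorial / c ^ M * Real.exp (c * (1 + t ^ 2))) *
          Real.exp (-(c * t ^ 2)) := by gcongr; exact h1.trans (by gcongr)
    _ = 2 ^ M * (M.factorial / c ^ M) *
          (Real.exp (c * (1 + t ^ 2)) * Real.exp (-(c * t ^ 2))) := by ring
    _ = _ := by rw [← Real.exp_add]; congr 2; ring

theorem hasTemperateGrowth_coord {n : ℕ} (i : Fin n) :
    (fun x : Fin n → ℝ => x i).HasTemperateGrowth :=
  (ContinuousLinearMap.proj (R := ℝ) (φ := fun _ : Fin n => ℝ) i).hasTemperateGrowth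

theorem hasTemperateGrowth_quad (n : ℕ) (c : ℝ) :
    (fun x : Fin n → ℝ => -(c * ∑ i, x i ^ 2)).HasTemperateGrowth := by
  have h1 : (fun x : Fin n → ℝ => ∑ i, x i ^ 2).HasTemperateGrowth :=
    Function.HasTemperateGrowth.sum fun i _ => (hasTemperateGrowth_coord i).pow 2
  exact ((Function.HasTemperateGrowth.const c).mul h1).neg

/-- `x ↦ exp(-c |x|²)` as a Schwartz function. -/
def gaussSchwartz (n : ℕ) (c : ℝ) (hc : 0 < c) : 𝓢(Fin n → ℝ, ℝ) where
  toFun := Real.exp ∘ fun x : Fin n → ℝ => -(c * ∑ i, x i ^ 2)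
  smooth' := Real.contDiff_exp.comp (hasTemperateGrowth_quad n c).1
  decay' k m := by
    have hq := hasTemperateGrowth_quad n c
    obtain ⟨j, C, hC, hb⟩ := hq.norm_iteratedFDeriv_le_uniform m
    obtain ⟨B, hB⟩ := exists_bound_pow_mul_exp hc (k + j * m)
    refine ⟨m.factorial * (C + 1) ^ m * B, fun x => ?_⟩
    have hx : ‖x‖ ^ 2 ≤ ∑ i, x i ^ 2 := by
      have h0 : 0 ≤ ∑ i, x i ^ 2 := Finset.sum_nonneg fun i _ => sq_nonneg _
      have : ‖x‖ ≤ Real.sqrt (∑ i, x i ^ 2) := by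
        refine (pi_norm_le_iff_of_nonneg (Real.sqrt_nonneg _)).2 fun i => ?_
        rw [Real.norm_eq_abs, ← Real.sqrt_sq_eq_abs]
        exact Real.sqrt_le_sqrt
          (Finset.single_le_sum (f := fun i => x i ^ 2) (fun i _ => sq_nonneg _)
            (Finset.mem_univ i))
      calc ‖x‖ ^ 2 ≤ Real.sqrt (∑ i, x i ^ 2) ^ 2 := by gcongr
        _ = _ := Real.sq_sqrt h0
    have hbase : 1 ≤ (C + 1) * (1 + ‖x‖) ^ j := by
      have : 1 ≤ (1 + ‖x‖) ^ j := one_le_pow₀ (by linarith [norm_nonneg x])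
      nlinarith
    have key := norm_iteratedFDeriv_comp_le (𝕜 := ℝ) (n := m) (N := (m : WithTop ℕ∞))
      Real.contDiff_exp (hq.1.of_le (by exact_mod_cast le_top)) le_rfl x
      (C := Real.exp (-(c * ∑ i, x i ^ 2))) (D := (C + 1) * (1 + ‖x‖) ^ j)
      (fun i _ => by
        rw [norm_iteratedFDeriv_eq_norm_iteratedDeriv, iteratedDeriv_eq_iterate,
          Real.iter_deriv_exp, Real.norm_eq_abs, abs_of_pos (Real.exp_pos _)])
      (fun i hi him => by
        refine (hb i him x).trans ?_
        refine le_trans ?_ (le_self_pow₀ hbase (by omega))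
        gcongr
        linarith)
    calc ‖x‖ ^ k * ‖iteratedFDeriv ℝ m _ x‖
        ≤ (1 + ‖x‖) ^ k * (m.factorial * Real.exp (-(c * ‖x‖ ^ 2)) *
            ((C + 1) * (1 + ‖x‖) ^ j) ^ m) := by
          refine mul_le_mul (pow_le_pow_left₀ (norm_nonneg x) (by linarith) k)
            (key.trans ?_) (norm_nonneg _) (by positivity)
          gcongr
      _ = m.factorial * (C + 1) ^ m *
            ((1 + ‖x‖) ^ (k + j * m) * Real.exp (-(c * ‖x‖ ^ 2))) := by
          rw [mul_pow, pow_add, pow_mul]; ring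
      _ ≤ _ := by gcongr; exact hB _ (norm_nonneg x)

theorem density_pos (n : ℕ) {Δt : ℝ} (h : 0 < Δt) (x : Fin n → ℝ) : 0 < density n Δt x := by
  unfold density; positivity

theorem continuous_density (n : ℕ) (Δt : ℝ) : Continuous (density n Δt) := by
  unfold density; fun_prop

/-- `√p^n` as a Schwartz function. -/
def sqrtDensity (n : ℕ) (Δt : ℝ) [h : Fact (0 < Δt)] : 𝓢(Fin n → ℝ, ℝ) :=
  Real.sqrt ((2 * Real.pi * Δt) ^ (-(n : ℝ) / 2)) •
    gaussSchwartz n (1 / (4 * Δt)) (by have := h.out; positivity)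

theorem sqrtDensity_eq (n : ℕ) (Δt : ℝ) [h : Fact (0 < Δt)] (x : Fin n → ℝ) :
    sqrtDensity n Δt x = Real.sqrt ((2 * Real.pi * Δt) ^ (-(n : ℝ) / 2)) *
      Real.exp (-(1 / (4 * Δt) * ∑ i, x i ^ 2)) := rfl

theorem sqrtDensity_apply (n : ℕ) (Δt : ℝ) [h : Fact (0 < Δt)] (x : Fin n → ℝ) :
    sqrtDensity n Δt x = Real.sqrt (density n Δt x) := by
  have h0 := h.out
  rw [sqrtDensity_eq, density, Real.sqrt_mul (by positivity), Real.sqrt_eq_rpow (Real.exp _),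
    ← Real.exp_mul]
  congr 2
  field_simp
  ring

theorem sqrtDensity_mul_self (n : ℕ) (Δt : ℝ) [h : Fact (0 < Δt)] (x : Fin n → ℝ) :
    sqrtDensity n Δt x * sqrtDensity n Δt x = density n Δt x := by
  rw [sqrtDensity_apply, Real.mul_self_sqrt (density_pos n h.out x).le]

/-! ### Generalized Wiener functionals -/

/-- The test functions: the Schwartz functions of the form `√p^n · f` with `f ∈ 𝒮(ℝⁿ)`.
(The sup norm of `Fin n → ℝ` and the Euclidean norm give the same Schwartz space.) -/
def testSpace (n : ℕ) (Δt : ℝ) : Submodule ℝ 𝓢(Fin n → ℝ, ℝ) where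
  carrier := {φ | ∃ f : 𝓢(Fin n → ℝ, ℝ), ∀ x, φ x = Real.sqrt (density n Δt x) * f x}
  zero_mem' := ⟨0, by simp⟩
  add_mem' := by
    rintro φ ψ ⟨f, hf⟩ ⟨g, hg⟩
    exact ⟨f + g, fun x => by simp [hf, hg, mul_add]⟩
  smul_mem' := by
    rintro c φ ⟨f, hf⟩
    exact ⟨c • f, fun x => by simp [hf, mul_left_comm]⟩

/-- A generalized Wiener functional `X` on `ℝⁿ`: a linear functional `φ ↦ ⟨X, φ⟩` on the test
functions, continuous in the sense that `f ↦ ⟨X, √p^n f⟩` is a tempered distribution, i.e.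
`X · √p^n ∈ 𝒮'(ℝⁿ)`. Every tempered distribution (`ofTempered`) and every element of `L²(μ^n)`
(`ofL2`) is one; elements of `L²(μ^n)` need not be tempered distributions themselves. -/
@[ext]
structure GenFunctional (n : ℕ) (Δt : ℝ) where
  /-- The coupling `φ ↦ ⟨X, φ⟩`. -/
  pair : testSpace n Δt →ₗ[ℝ] ℝ
  continuous_pair : ∃ U : 𝓢(Fin n → ℝ, ℝ) →L[ℝ] ℝ,
    ∀ (φ : testSpace n Δt) (f : 𝓢(Fin n → ℝ, ℝ)),
      (∀ x, φ.1 x = Real.sqrt (density n Δt x) * f x) → pair φ = U f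

/-- Multiplication by `√p^n` followed by `∂_k`, divided by `√p^n`:
`f ↦ ∂_k f - x_k/(2Δt) f`. -/
def conjDeriv {n : ℕ} (Δt : ℝ) (k : Fin n) : 𝓢(Fin n → ℝ, ℝ) →L[ℝ] 𝓢(Fin n → ℝ, ℝ) :=
  lineDerivOpCLM ℝ 𝓢(Fin n → ℝ, ℝ) (Pi.single k 1 : Fin n → ℝ) -
    (1 / (2 * Δt)) • smulLeftCLM ℝ (fun x : Fin n → ℝ => x k)

theorem lineDeriv_sqrt_mul {n : ℕ} {Δt : ℝ} [h : Fact (0 < Δt)] (k : Fin n)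
    {φ f : 𝓢(Fin n → ℝ, ℝ)} (hφ : ∀ x, φ x = Real.sqrt (density n Δt x) * f x)
    (x : Fin n → ℝ) :
    (∂_{(Pi.single k 1 : Fin n → ℝ)} φ) x =
      Real.sqrt (density n Δt x) * conjDeriv Δt k f x := by
  have h0 := h.out
  set K := Real.sqrt ((2 * Real.pi * Δt) ^ (-(n : ℝ) / 2)) with hK
  have hφ' : (φ : (Fin n → ℝ) → ℝ) = fun x =>
      (K * Real.exp (-(1 / (4 * Δt) * ∑ i, x i ^ 2))) * f x := by
    funext y; rw [hφ y, ← sqrtDensity_apply, sqrtDensity_eq]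
  have hsum : HasFDerivAt (fun y : Fin n → ℝ => ∑ i, y i ^ 2)
      (∑ i, (2 * x i) • ContinuousLinearMap.proj (R := ℝ) (φ := fun _ : Fin n => ℝ) i) x := by
    refine HasFDerivAt.fun_sum fun i _ => ?_
    have hp : HasFDerivAt (fun y : Fin n → ℝ => y i)
        (ContinuousLinearMap.proj (R := ℝ) (φ := fun _ : Fin n => ℝ) i) x :=
      (ContinuousLinearMap.proj (R := ℝ) (φ := fun _ : Fin n => ℝ) i).hasFDerivAt
    simpa using hp.pow 2
  have hd := (((hsum.const_mul (1 / (4 * Δt))).neg.exp).const_mul K).mul (f.hasFDerivAt x)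
  have hfd := hd.fderiv
  rw [lineDerivOp_apply_eq_fderiv, hφ']
  refine (congrArg (fun L => L (Pi.single k 1)) hfd).trans ?_
  rw [← sqrtDensity_apply, sqrtDensity_eq]
  have e : conjDeriv Δt k f x = fderiv ℝ f x (Pi.single k 1) - 1 / (2 * Δt) * (x k * f x) := by
    simp [conjDeriv, lineDerivOp_apply_eq_fderiv,
      smulLeftCLM_apply_apply (hasTemperateGrowth_coord k)]
  rw [e]
  have e2 : (∑ i, (2 * x i) • ContinuousLinearMap.proj (R := ℝ) (φ := fun _ : Fin n => ℝ) i)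
      (Pi.single k 1) = 2 * x k := by
    simp [Pi.single_apply]
  simp only [add_apply, smul_apply, neg_apply, e2, smul_eq_mul, Pi.neg_apply]
  rw [← hK]
  generalize Real.exp (-(1 / (4 * Δt) * ∑ i, x i ^ 2)) = E
  field_simp
  ring

/-- `∂_k` maps test functions to test functions. -/
def testDeriv {n : ℕ} {Δt : ℝ} [Fact (0 < Δt)] (k : Fin n) :
    testSpace n Δt →ₗ[ℝ] testSpace n Δt :=
  (lineDerivOpCLM ℝ 𝓢(Fin n → ℝ, ℝ) (Pi.single k 1 : Fin n → ℝ)).toLinearMap.restrict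
    (by
      rintro φ ⟨f, hf⟩
      exact ⟨conjDeriv Δt k f, fun x => lineDeriv_sqrt_mul k hf x⟩)

/-- The distributional partial derivative: `⟨∂_k X, φ⟩ = -⟨X, ∂_k φ⟩`. -/
def GenFunctional.deriv {n : ℕ} {Δt : ℝ} [Fact (0 < Δt)] (k : Fin n)
    (X : GenFunctional n Δt) : GenFunctional n Δt where
  pair := -(X.pair ∘ₗ testDeriv k)
  continuous_pair := by
    obtain ⟨U, hU⟩ := X.continuous_pair
    refine ⟨-(U ∘L conjDeriv Δt k), fun φ f hf => ?_⟩
    have := hU (testDeriv k φ) (conjDeriv Δt k f) fun x => lineDeriv_sqrt_mul k hf x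
    simp [this]

/-- The generalized functional given by a tempered distribution, by restriction. -/
def GenFunctional.ofTempered {n : ℕ} {Δt : ℝ} [Fact (0 < Δt)]
    (T : 𝓢(Fin n → ℝ, ℝ) →L[ℝ] ℝ) : GenFunctional n Δt where
  pair := T.toLinearMap ∘ₗ (testSpace n Δt).subtype
  continuous_pair := by
    refine ⟨T ∘L smulLeftCLM ℝ (sqrtDensity n Δt), fun φ f hf => ?_⟩
    have : φ.1 = smulLeftCLM ℝ (sqrtDensity n Δt) f := by
      ext x
      rw [smulLeftCLM_apply_apply (sqrtDensity n Δt).hasTemperateGrowth, hf, sqrtDensity_apply,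
        smul_eq_mul]
    simp [this]

theorem memLp_mul_sqrtDensity {n : ℕ} {Δt : ℝ} [h : Fact (0 < Δt)]
    (X : Lp ℝ 2 (gaussianMeasure n Δt)) :
    MemLp (fun x => X x * Real.sqrt (density n Δt x)) 2 volume := by
  have hm : Measurable fun x => ENNReal.ofReal (density n Δt x) :=
    (continuous_density n Δt).measurable.ennreal_ofReal
  have hac : (volume : Measure (Fin n → ℝ)) ≪ gaussianMeasure n Δt :=
    withDensity_absolutelyContinuous' hm.aemeasurable
      (Filter.Eventually.of_forall fun x => by simpa using density_pos n h.out x)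
  have hX := Lp.memLp X
  have hsm : AEStronglyMeasurable (fun x => X x * Real.sqrt (density n Δt x)) volume :=
    (hX.1.mono_ac hac).mul
      (Real.continuous_sqrt.comp (continuous_density n Δt)).aestronglyMeasurable
  rw [memLp_two_iff_integrable_sq hsm]
  have hi := (memLp_two_iff_integrable_sq hX.1).1 hX
  unfold gaussianMeasure at hi
  have hi := (integrable_withDensity_iff hm (by simp)).1 hi
  refine hi.congr (Filter.Eventually.of_forall fun x => ?_)
  have hp := (density_pos n h.out x).le
  simp only [mul_pow, Real.sq_sqrt hp, ENNReal.toReal_ofReal hp]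
  rfl

theorem integrable_mul_test {n : ℕ} {Δt : ℝ} [Fact (0 < Δt)]
    (X : Lp ℝ 2 (gaussianMeasure n Δt)) (φ : testSpace n Δt) :
    Integrable (fun x => X x * φ.1 x) := by
  obtain ⟨f, hf⟩ := φ.2
  refine ((memLp_mul_sqrtDensity X).integrable_mul (f.memLp 2)).congr
    (Filter.Eventually.of_forall fun x => ?_)
  simp [hf x, mul_assoc]

/-- The generalized functional `⟨X, φ⟩ = ∫ X(x) φ(x) dx` given by `X ∈ L²(μ^n)`. -/
def GenFunctional.ofL2 {n : ℕ} {Δt : ℝ} [Fact (0 < Δt)]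
    (X : Lp ℝ 2 (gaussianMeasure n Δt)) : GenFunctional n Δt where
  pair :=
    { toFun := fun φ => ∫ x, X x * φ.1 x
      map_add' := fun φ ψ => by
        rw [← integral_add (integrable_mul_test X φ) (integrable_mul_test X ψ)]
        simp [mul_add]
      map_smul' := fun c φ => by
        rw [RingHom.id_apply, smul_eq_mul, ← integral_const_mul]
        simp [mul_left_comm] }
  continuous_pair := by
    have hX := memLp_mul_sqrtDensity X
    refine ⟨innerSL ℝ hX.toLp ∘L toLpCLM ℝ ℝ 2 volume, fun φ f hf => ?_⟩
    change ∫ x, X x * φ.1 x = inner ℝ hX.toLp (f.toLp 2)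
    rw [L2.inner_def]
    refine integral_congr_ae ?_
    filter_upwards [hX.coeFn_toLp, f.coeFn_toLp 2] with x h1 h2
    rw [h1, h2, hf x]
    simp
    ring

/-- On tempered distributions, `deriv` is the usual distributional derivative. -/
theorem GenFunctional.deriv_ofTempered {n : ℕ} {Δt : ℝ} [Fact (0 < Δt)] (k : Fin n)
    (T : 𝓢(Fin n → ℝ, ℝ) →L[ℝ] ℝ) :
    (ofTempered T : GenFunctional n Δt).deriv k =
      ofTempered (-(T ∘L lineDerivOpCLM ℝ 𝓢(Fin n → ℝ, ℝ) (Pi.single k 1 : Fin n → ℝ))) := by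
  ext φ; rfl

/-- If `X ∈ L²(μ^n)` is a tempered distribution, then `ofL2 X` is that distribution. -/
theorem GenFunctional.ofL2_eq_ofTempered {n : ℕ} {Δt : ℝ} [Fact (0 < Δt)]
    (X : Lp ℝ 2 (gaussianMeasure n Δt)) (T : 𝓢(Fin n → ℝ, ℝ) →L[ℝ] ℝ)
    (hT : ∀ φ : 𝓢(Fin n → ℝ, ℝ), T φ = ∫ x, X x * φ x) : ofL2 X = ofTempered T := by
  ext φ; exact (hT φ.1).symm

/-- For `Z ∈ 𝒮(ℝᵏ)`, `k ≤ n`, the test function `Z p^n : x ↦ Z(x_1, …, x_k) p^n(x)` on `ℝⁿ`. -/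
def mulDensity {k n : ℕ} {Δt : ℝ} [Fact (0 < Δt)] (h : k ≤ n) (Z : 𝓢(Fin k → ℝ, ℝ)) :
    testSpace n Δt :=
  ⟨smulLeftCLM ℝ (fun x => Z (firstCoords h x))
      (smulLeftCLM ℝ (sqrtDensity n Δt) (sqrtDensity n Δt)),
    smulLeftCLM ℝ (fun x => Z (firstCoords h x)) (sqrtDensity n Δt), fun x => by
      have hZ : (fun x => Z (firstCoords h x)).HasTemperateGrowth :=
        Z.hasTemperateGrowth.comp (ContinuousLinearMap.pi fun i : Fin k =>
          ContinuousLinearMap.proj (R := ℝ) (φ := fun _ : Fin n => ℝ)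
            (Fin.castLE h i)).hasTemperateGrowth
      rw [smulLeftCLM_apply_apply hZ, smulLeftCLM_apply_apply hZ,
        smulLeftCLM_apply_apply (sqrtDensity n Δt).hasTemperateGrowth, ← sqrtDensity_apply]
      simp only [smul_eq_mul]
      ring⟩

theorem mulDensity_apply {k n : ℕ} {Δt : ℝ} [Fact (0 < Δt)] (h : k ≤ n)
    (Z : 𝓢(Fin k → ℝ, ℝ)) (x : Fin n → ℝ) :
    (mulDensity (Δt := Δt) h Z).1 x = Z (firstCoords h x) * density n Δt x := by
  have hZ : (fun x => Z (firstCoords h x)).HasTemperateGrowth :=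
    Z.hasTemperateGrowth.comp (ContinuousLinearMap.pi fun i : Fin k =>
      ContinuousLinearMap.proj (R := ℝ) (φ := fun _ : Fin n => ℝ)
        (Fin.castLE h i)).hasTemperateGrowth
  simp only [mulDensity]
  rw [smulLeftCLM_apply_apply hZ,
    smulLeftCLM_apply_apply (sqrtDensity n Δt).hasTemperateGrowth, smul_eq_mul, smul_eq_mul,
    sqrtDensity_mul_self]

/-- `Y = E[X | 𝒢_k]` in the generalized sense: `⟨X, Z p^n⟩ = ⟨Y, Z p^k⟩` for all `Z ∈ 𝒮(ℝᵏ)`. -/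
def IsCondExp {k n : ℕ} {Δt : ℝ} [Fact (0 < Δt)] (h : k ≤ n)
    (X : GenFunctional n Δt) (Y : GenFunctional k Δt) : Prop :=
  ∀ Z : 𝓢(Fin k → ℝ, ℝ), X.pair (mulDensity h Z) = Y.pair (mulDensity le_rfl Z)

/-- The `(m, l)` summand `Δt^(m/2)/√(m!) · Y(ΔW_1, …, ΔW_{l-1}) · H_m(ΔW_l/√Δt)`, a function on
`ℝᴺ`; the index `l : Fin N` starts at `0`, so `l` is the number of preceding coordinates. -/
def summand {N : ℕ} (Δt : ℝ) (m : ℕ) (l : Fin N) (Y : (Fin l → ℝ) → ℝ) (x : Fin N → ℝ) : ℝ :=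
  Δt ^ ((m : ℝ) / 2) / Real.sqrt (m.factorial : ℝ) * Y (firstCoords l.isLt.le x) *
    hermiteH m (x l / Real.sqrt Δt)

end DiscreteWiener

end

open DiscreteWiener

noncomputable section

namespace DiscreteWiener

open ProbabilityTheory Polynomial
open scoped NNReal ENNReal

/-! ### Hermite polynomials and the Gaussian law on the line -/

/-! The space L²(μ^N) is the orthogonal sum of the constants and the spaces of functions
`Y(increments before l) * H_m(ΔW_l/√Δt)`, over all `l` and all `m ≥ 1`. Each is the range of an
isometry V_{m,l} (`chaosIsometry`), so X - E[X] is the unconditional sum of V_{m,l} V_{m,l}* X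
(`hasSum_comp_adjoint`). Orthogonality comes from independence of the increments and from
orthonormality of the H_m, which have mean zero for `m ≥ 1`.

Totality: a function f orthogonal to the constants and to all these spaces is orthogonal to every
polynomial, by induction on the number of coordinates. The measures f⁺μ and f⁻μ then give equal
moments to every linear form. Since f is in L², they have all exponential moments, so the moments
determine their characteristic functions, and f⁺ = f⁻ almost everywhere
(`eq_zero_of_integral_linear_pow`).

The adjoint is the conditional expectation (`isCondExp_chaosKernel`): in ⟨∂_l^m X, Z p^N⟩ the
derivatives move to Z p^N. As Z does not involve the coordinate `l`, they act on the density alone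
and produce the Hermite polynomial of degree m, which leaves Δt^(-m/2) √(m!) ⟨V_{m,l} Z, X⟩.
Uniqueness holds because the products Z √p contain all smooth compactly supported functions, which
are dense in the Schwartz space (`GenFunctional.ext_mulDensity`). -/

theorem hermiteH_eq (m : ℕ) (x : ℝ) :
    hermiteH m x = aeval x (hermite m) / Real.sqrt (m.factorial : ℝ) := by
  have h : (fun y : ℝ => Real.exp (-y ^ 2 / 2)) = fun y => Real.exp (-(y ^ 2 / 2)) := by
    funext y; congr 1; ring
  rw [hermiteH, h, iteratedDeriv_eq_iterate, hermite_eq_deriv_gaussian']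
  ring

theorem hermiteH_zero (x : ℝ) : hermiteH 0 x = 1 := by simp [hermiteH_eq]

theorem continuous_hermiteH (m : ℕ) : Continuous (hermiteH m) := by
  have : hermiteH m = fun x => aeval x (hermite m) / Real.sqrt (m.factorial : ℝ) :=
    funext (hermiteH_eq m)
  rw [this]
  exact (Polynomial.continuous_aeval _).div_const _

theorem integrable_polynomial_gaussianReal (q : ℝ[X]) (v : ℝ≥0) :
    Integrable (fun x => q.eval x) (gaussianReal 0 v) := by
  simp_rw [Polynomial.eval_eq_sum_range]
  refine integrable_finsetSum _ fun i _ => Integrable.const_mul ?_ _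
  exact integrable_pow_of_mem_interior_integrableExpSet (X := id) (by simp) i

theorem memLp_polynomial_gaussianReal (q : ℝ[X]) (v : ℝ≥0) :
    MemLp (fun x => q.eval x) 2 (gaussianReal 0 v) := by
  rw [memLp_two_iff_integrable_sq q.continuous.aestronglyMeasurable]
  exact (integrable_polynomial_gaussianReal (q ^ 2) v).congr
    (ae_of_all _ fun x => Polynomial.eval_pow 2)

theorem integrable_polynomial_mul_gaussianPDFReal (q : ℝ[X]) :
    Integrable (fun x => q.eval x * gaussianPDFReal 0 1 x) := by
  have h := integrable_polynomial_gaussianReal q 1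
  rw [gaussianReal_of_var_ne_zero _ one_ne_zero,
    integrable_withDensity_iff_integrable_smul' (measurable_gaussianPDF 0 1)
      (ae_of_all _ fun _ => gaussianPDF_lt_top)] at h
  refine h.congr (ae_of_all _ fun x => ?_)
  simp [toReal_gaussianPDF, mul_comm]

/-- The Hermite polynomials with real coefficients. -/
def realHermite (n : ℕ) : ℝ[X] := (hermite n).map (Int.castRingHom ℝ)

theorem realHermite_succ (n : ℕ) :
    realHermite (n + 1) = X * realHermite n - derivative (realHermite n) := by
  simp [realHermite, hermite_succ, derivative_map]

theorem realHermite_zero : realHermite 0 = 1 := by simp [realHermite]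

theorem monic_realHermite (n : ℕ) : (realHermite n).Monic := (hermite_monic n).map _

theorem natDegree_realHermite (n : ℕ) : (realHermite n).natDegree = n := by
  rw [realHermite, (hermite_monic n).natDegree_map, natDegree_hermite]

theorem hermiteH_eq_eval (m : ℕ) (x : ℝ) :
    hermiteH m x = (realHermite m).eval x / Real.sqrt (m.factorial : ℝ) := by
  rw [hermiteH_eq, realHermite, eval_map, aeval_def]; rfl

theorem hasDerivAt_gaussianPDFReal (x : ℝ) :
    HasDerivAt (gaussianPDFReal 0 1) (-x * gaussianPDFReal 0 1 x) x := by
  have h : HasDerivAt (fun x : ℝ => -(x - 0) ^ 2 / (2 * ((1 : ℝ≥0) : ℝ))) (-x) x := by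
    have := ((((hasDerivAt_id x).sub_const 0).pow 2).neg).div_const (2 * ((1 : ℝ≥0) : ℝ))
    refine this.congr_deriv ?_
    simp
    ring
  rw [gaussianPDFReal_def]
  refine (h.exp.const_mul _).congr_deriv ?_
  ring

/-- Integration by parts against a Hermite polynomial. -/
theorem integral_mul_realHermite_succ (q : ℝ[X]) (n : ℕ) :
    ∫ x, (q * realHermite (n + 1)).eval x ∂gaussianReal 0 1 =
      ∫ x, (derivative q * realHermite n).eval x ∂gaussianReal 0 1 := by
  rw [integral_gaussianReal_eq_integral_smul one_ne_zero,
    integral_gaussianReal_eq_integral_smul one_ne_zero]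
  -- With p the Gaussian density, the Hermite recursion says (He_n p)' = -He_{n+1} p, and
  -- integrability of all the products disposes of the boundary terms.
  have h := integral_mul_deriv_eq_deriv_mul_of_integrable
    (u := fun x => q.eval x) (u' := fun x => (derivative q).eval x)
    (v := fun x => (realHermite n).eval x * gaussianPDFReal 0 1 x)
    (v' := fun x => -((realHermite (n + 1)).eval x * gaussianPDFReal 0 1 x))
    (fun x _ => q.hasDerivAt x)
    (fun x _ => by
      refine (((realHermite n).hasDerivAt x).mul (hasDerivAt_gaussianPDFReal x)).congr_deriv ?_
      rw [realHermite_succ]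
      simp
      ring)
    ?_ ?_ ?_
  · simp only [eval_mul, smul_eq_mul]
    simp only [mul_neg, integral_neg, neg_inj] at h
    refine Eq.trans (integral_congr_ae (ae_of_all _ fun x => ?_)) (h.trans
      (integral_congr_ae (ae_of_all _ fun x => ?_)))
    · simp; ring
    · simp; ring
  · refine (integrable_polynomial_mul_gaussianPDFReal (-(q * realHermite (n + 1)))).congr
      (ae_of_all _ fun x => ?_)
    simp; ring
  · refine (integrable_polynomial_mul_gaussianPDFReal (derivative q * realHermite n)).congr
      (ae_of_all _ fun x => ?_)
    simp; ring
  · refine (integrable_polynomial_mul_gaussianPDFReal (q * realHermite n)).congr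
      (ae_of_all _ fun x => ?_)
    simp; ring

/-- Reduces orthogonality to counting degrees: the n-th derivative kills `q` of degree below n and
turns a monic `q` of degree n into n!. -/
theorem integral_mul_realHermite (q : ℝ[X]) (n : ℕ) :
    ∫ x, (q * realHermite n).eval x ∂gaussianReal 0 1 =
      ∫ x, (derivative^[n] q).eval x ∂gaussianReal 0 1 := by
  induction n generalizing q with
  | zero => simp [realHermite_zero]
  | succ n ih => rw [integral_mul_realHermite_succ, ih, Function.iterate_succ_apply]

theorem integral_realHermite_mul_self (n : ℕ) :
    ∫ x, (realHermite n * realHermite n).eval x ∂gaussianReal 0 1 = n.factorial := by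
  have h : derivative^[n] (realHermite n) = C (n.factorial : ℝ) := by
    have hd : (derivative^[n] (realHermite n)).natDegree = 0 := by
      have := natDegree_iterate_derivative (realHermite n) n
      rw [natDegree_realHermite] at this
      omega
    rw [eq_C_of_natDegree_eq_zero hd, coeff_iterate_derivative]
    have : (realHermite n).coeff n = 1 := by
      have := monic_realHermite n
      rwa [Monic, leadingCoeff, natDegree_realHermite] at this
    simp [this, Nat.descFactorial_self]
  rw [integral_mul_realHermite, h]
  simp

theorem integral_realHermite_mul_of_lt {m n : ℕ} (h : m < n) :
    ∫ x, (realHermite m * realHermite n).eval x ∂gaussianReal 0 1 = 0 := by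
  rw [integral_mul_realHermite, iterate_derivative_eq_zero (by rwa [natDegree_realHermite])]
  simp

theorem integral_hermiteH_mul (m n : ℕ) :
    ∫ x, hermiteH m x * hermiteH n x ∂gaussianReal 0 1 = if m = n then 1 else 0 := by
  have e : ∀ x, hermiteH m x * hermiteH n x = (realHermite m * realHermite n).eval x /
      (Real.sqrt (m.factorial : ℝ) * Real.sqrt (n.factorial : ℝ)) := fun x => by
    rw [hermiteH_eq_eval, hermiteH_eq_eval, eval_mul]; ring
  simp_rw [e, integral_div]
  split_ifs with hmn
  · subst hmn
    rw [integral_realHermite_mul_self, Real.mul_self_sqrt (by positivity)]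
    exact div_self (by positivity)
  · rcases lt_or_gt_of_ne hmn with h | h
    · rw [integral_realHermite_mul_of_lt h, zero_div]
    · rw [mul_comm (realHermite m), integral_realHermite_mul_of_lt h, zero_div]

/-- The one-dimensional Gaussian law `N(0, Δt)`. -/
def gaussianLaw (Δt : ℝ) : Measure ℝ := gaussianReal 0 Δt.toNNReal

instance (Δt : ℝ) : IsProbabilityMeasure (gaussianLaw Δt) := by unfold gaussianLaw; infer_instance

theorem map_div_sqrt_gaussianLaw (Δt : ℝ) [h : Fact (0 < Δt)] :
    (gaussianLaw Δt).map (fun x => x / Real.sqrt Δt) = gaussianReal 0 1 := by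
  have h0 := h.out
  rw [gaussianLaw, gaussianReal_map_div_const, zero_div]
  congr 1
  ext
  simp [h0.le, h0.ne']

theorem integral_hermiteH_mul_gaussianLaw (Δt : ℝ) [Fact (0 < Δt)] (m n : ℕ) :
    ∫ x, hermiteH m (x / Real.sqrt Δt) * hermiteH n (x / Real.sqrt Δt) ∂gaussianLaw Δt =
      if m = n then 1 else 0 := by
  rw [← integral_hermiteH_mul, ← map_div_sqrt_gaussianLaw Δt, integral_map (by fun_prop)
    (Continuous.aestronglyMeasurable (by
      have := continuous_hermiteH m
      have := continuous_hermiteH n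
      fun_prop))]

theorem integral_hermiteH_gaussianLaw (Δt : ℝ) [Fact (0 < Δt)] {m : ℕ} (hm : m ≠ 0) :
    ∫ x, hermiteH m (x / Real.sqrt Δt) ∂gaussianLaw Δt = 0 := by
  have := integral_hermiteH_mul_gaussianLaw Δt m 0
  simpa [hermiteH_zero, hm] using this

theorem memLp_polynomial_gaussianLaw (Δt : ℝ) (q : ℝ[X]) :
    MemLp (fun x => q.eval x) 2 (gaussianLaw Δt) := memLp_polynomial_gaussianReal q _

theorem memLp_hermiteH_gaussianLaw (Δt : ℝ) (m : ℕ) :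
    MemLp (fun x => hermiteH m (x / Real.sqrt Δt)) 2 (gaussianLaw Δt) := by
  refine (memLp_polynomial_gaussianLaw Δt
    (C (Real.sqrt (m.factorial : ℝ))⁻¹ *
      (realHermite m).comp (C (Real.sqrt Δt)⁻¹ * X))).ae_eq (ae_of_all _ fun x => ?_)
  simp [hermiteH_eq_eval, div_eq_inv_mul]

/-! ### Product structure of the Gaussian measure -/

theorem density_eq_prod (n : ℕ) (Δt : ℝ) [h : Fact (0 < Δt)] (x : Fin n → ℝ) :
    density n Δt x = ∏ i, gaussianPDFReal 0 Δt.toNNReal (x i) := by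
  have h0 := h.out
  simp only [gaussianPDFReal, Real.coe_toNNReal _ h0.le, Finset.prod_mul_distrib, sub_zero,
    ← Real.exp_sum, Finset.prod_const, Finset.card_univ, Fintype.card_fin, density]
  congr 1
  · rw [Real.sqrt_eq_rpow, ← Real.rpow_neg (by positivity), ← Real.rpow_natCast,
      ← Real.rpow_mul (by positivity)]
    congr 1; ring
  · rw [← Finset.sum_div, Finset.sum_neg_distrib]

theorem gaussianMeasure_eq_pi (n : ℕ) (Δt : ℝ) [h : Fact (0 < Δt)] :
    gaussianMeasure n Δt = Measure.pi fun _ => gaussianLaw Δt := by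
  have h0 : Δt.toNNReal ≠ 0 := by simpa using h.out
  refine (Measure.pi_eq fun s hs => ?_).symm
  rw [gaussianMeasure, withDensity_apply _ (MeasurableSet.univ_pi hs), volume_pi,
    Measure.restrict_pi_pi]
  simp_rw [density_eq_prod]
  rw [← ofReal_integral_eq_lintegral_ofReal
    (Integrable.fintype_prod fun i => (integrable_gaussianPDFReal 0 _).restrict)
    (ae_of_all _ fun x => Finset.prod_nonneg fun i _ => gaussianPDFReal_nonneg _ _ _),
    integral_fintype_prod_eq_prod, ENNReal.ofReal_prod_of_nonneg
    fun i _ => integral_nonneg fun x => gaussianPDFReal_nonneg _ _ _]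
  refine Finset.prod_congr rfl fun i _ => ?_
  rw [gaussianLaw, gaussianReal_apply_eq_integral _ h0]

instance (n : ℕ) (Δt : ℝ) [Fact (0 < Δt)] : IsProbabilityMeasure (gaussianMeasure n Δt) := by
  rw [gaussianMeasure_eq_pi]; infer_instance

/-- Selecting distinct coordinates preserves powers of a probability measure. -/
theorem measurePreserving_comp_injective {k n : ℕ} {σ : Fin k → Fin n}
    (hσ : Function.Injective σ) (ν : Measure ℝ) [IsProbabilityMeasure ν] :
    MeasurePreserving (fun (x : Fin n → ℝ) i => x (σ i)) (Measure.pi fun _ => ν)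
      (Measure.pi fun _ => ν) := by
  classical
  refine ⟨by fun_prop, (Measure.pi_eq fun s hs => ?_).symm⟩
  rw [Measure.map_apply (by fun_prop) (MeasurableSet.univ_pi hs)]
  -- A coordinate outside the range of `σ` gets the empty intersection, the whole line, of mass one;
  -- injectivity leaves a single set on every other coordinate.
  have e : (fun (x : Fin n → ℝ) i => x (σ i)) ⁻¹' (Set.univ.pi s) =
      Set.univ.pi fun j => ⋂ (i) (_ : σ i = j), s i := by
    ext x
    simp only [Set.mem_preimage, Set.mem_pi, Set.mem_univ, true_implies, Set.mem_iInter]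
    exact ⟨fun hx j i hi => hi ▸ hx i, fun hx i => hx _ i rfl⟩
  rw [e, Measure.pi_pi]
  have e2 : ∀ i, (⋂ (i') (_ : σ i' = σ i), s i') = s i := fun i => by
    ext y
    simp only [Set.mem_iInter]
    exact ⟨fun hy => hy i rfl, fun hy i' hi => hσ hi ▸ hy⟩
  have e3 := Finset.prod_subset (Finset.subset_univ (Finset.univ.image σ))
    (f := fun j => ν (⋂ (i) (_ : σ i = j), s i)) (fun j _ hj => by
      have : ∀ i, σ i ≠ j := fun i hi => hj (by simp [← hi])
      simp [this])
  rw [← e3, Finset.prod_image fun a _ b _ hab => hσ hab]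
  simp_rw [e2]

theorem measurePreserving_firstCoords {k n : ℕ} (h : k ≤ n) (Δt : ℝ) [Fact (0 < Δt)] :
    MeasurePreserving (firstCoords h) (gaussianMeasure n Δt) (gaussianMeasure k Δt) := by
  rw [gaussianMeasure_eq_pi, gaussianMeasure_eq_pi]
  exact measurePreserving_comp_injective (Fin.castLE_injective h) _

/-- The increments before time `l` together with the increment at time `l`. -/
def splitAt {N : ℕ} (l : Fin N) (x : Fin N → ℝ) : (Fin l → ℝ) × ℝ :=
  (firstCoords l.isLt.le x, x l)

theorem measurePreserving_splitAt {N : ℕ} (l : Fin N) (Δt : ℝ) [Fact (0 < Δt)] :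
    MeasurePreserving (splitAt l) (gaussianMeasure N Δt)
      ((gaussianMeasure l Δt).prod (gaussianLaw Δt)) := by
  -- The coordinates after `l` are dropped first; what remains is splitting off the last of `l + 1`
  -- coordinates.
  have h1 := measurePreserving_firstCoords (n := N) (k := l + 1) l.isLt Δt
  have h2 : MeasurePreserving (fun x : Fin (l + 1) → ℝ => (fun i : Fin l => x i.castSucc,
      x (Fin.last l))) (gaussianMeasure (l + 1) Δt)
      ((gaussianMeasure l Δt).prod (gaussianLaw Δt)) := by
    have h3 := (measurePreserving_piFinSuccAbove (fun _ : Fin (l + 1) => gaussianLaw Δt)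
      (Fin.last l))
    have h4 := Measure.measurePreserving_swap.comp h3
    rw [gaussianMeasure_eq_pi, gaussianMeasure_eq_pi]
    convert! h4 using 1
    funext x
    refine Prod.ext ?_ rfl
    funext i
    simp only [Function.comp_apply, MeasurableEquiv.piFinSuccAbove]
    simp
    rfl
  exact h2.comp h1

/-! ### Orthogonal expansions -/

/-- Expansion of a vector along an orthogonal family of isometries which, together with the unit
vector `e`, is total. -/
theorem hasSum_comp_adjoint {ι E : Type*} {G : ι → Type*} [NormedAddCommGroup E]
    [InnerProductSpace ℝ E] [CompleteSpace E] [∀ i, NormedAddCommGroup (G i)]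
    [∀ i, InnerProductSpace ℝ (G i)] [∀ i, CompleteSpace (G i)] {V : ∀ i, G i →ₗᵢ[ℝ] E}
    (hV : OrthogonalFamily ℝ G V) {e : E} (he : ‖e‖ = 1) (heV : ∀ i y, inner ℝ e (V i y) = 0)
    (htotal : ∀ x : E, inner ℝ e x = 0 → (∀ i y, inner ℝ (V i y) x = 0) → x = 0) (x : E) :
    HasSum (fun i => V i ((V i).toContinuousLinearMap.adjoint x)) (x - inner ℝ e x • e) := by
  classical
  set w : ∀ i, G i := fun i => (V i).toContinuousLinearMap.adjoint x with hw
  have hinner : ∀ i y, inner ℝ (V i y) x = inner ℝ y (w i) := fun i y => by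
    rw [hw, ContinuousLinearMap.adjoint_inner_right]; rfl
  -- Bessel's inequality: the partial sum p satisfies ‖p‖² = ⟨p, x⟩ ≤ ‖p‖ ‖x‖.
  have hbessel : ∀ s : Finset ι, ∑ i ∈ s, ‖w i‖ ^ 2 ≤ ‖x‖ ^ 2 := fun s => by
    have h1 : ‖∑ i ∈ s, V i (w i)‖ ^ 2 = ∑ i ∈ s, ‖w i‖ ^ 2 := hV.norm_sum _ _
    have h2 : inner ℝ (∑ i ∈ s, V i (w i)) x = ∑ i ∈ s, ‖w i‖ ^ 2 := by
      rw [sum_inner]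
      exact Finset.sum_congr rfl fun i _ => by rw [hinner, real_inner_self_eq_norm_sq]
    have h3 := real_inner_le_norm (∑ i ∈ s, V i (w i)) x
    rw [h2, ← h1] at h3
    rw [← h1]
    rcases (norm_nonneg (∑ i ∈ s, V i (w i))).eq_or_lt with h0 | h0
    · rw [← h0, zero_pow two_ne_zero]; positivity
    · have : ‖∑ i ∈ s, V i (w i)‖ ≤ ‖x‖ := by
        rw [pow_two] at h3; exact le_of_mul_le_mul_left h3 h0
      gcongr
  have hsum : Summable fun i => V i (w i) :=
    (hV.summable_iff_norm_sq_summable w).2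
      (summable_of_sum_le (fun i => by positivity) hbessel)
  obtain ⟨S, hS⟩ := hsum
  have heS : inner ℝ e S = 0 := by
    have := hS.mapL (innerSL ℝ e)
    simp only [innerSL_apply_apply, heV] at this
    exact this.unique hasSum_zero
  have hVS : ∀ j y, inner ℝ (V j y) S = inner ℝ y (w j) := fun j y => by
    have h1 := hS.mapL (innerSL ℝ (V j y))
    simp only [innerSL_apply_apply] at h1
    have h2 := hasSum_single (f := fun i => inner ℝ (V j y) (V i (w i))) j
      fun i hi => hV hi.symm y (w i)
    rw [h1.unique h2, LinearIsometry.inner_map_map]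
  -- The remainder is orthogonal to `e` and to every range, so totality makes it vanish.
  have hzero : x - inner ℝ e x • e - S = 0 := by
    refine htotal _ ?_ fun i y => ?_
    · rw [inner_sub_right, inner_sub_right, inner_smul_right, heS,
        real_inner_self_eq_norm_sq, he]
      simp
    · rw [inner_sub_right, inner_sub_right, inner_smul_right, hVS, hinner,
        real_inner_comm e, heV]
      simp
  rwa [sub_eq_zero.1 hzero]

/-! ### The chaos isometries -/

theorem memLp_comp_firstCoords_mul {N : ℕ} {Δt : ℝ} [Fact (0 < Δt)] (l : Fin N)
    {Y : (Fin l → ℝ) → ℝ} (hY : MemLp Y 2 (gaussianMeasure l Δt)) {g : ℝ → ℝ}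
    (hg : MemLp g 2 (gaussianLaw Δt)) :
    MemLp (fun x : Fin N → ℝ => Y (firstCoords l.isLt.le x) * g (x l)) 2
      (gaussianMeasure N Δt) := by
  have h1 : AEStronglyMeasurable (fun z : (Fin l → ℝ) × ℝ => Y z.1 * g z.2)
      ((gaussianMeasure l Δt).prod (gaussianLaw Δt)) := hY.1.comp_fst.mul hg.1.comp_snd
  have h2 : MemLp (fun z : (Fin l → ℝ) × ℝ => Y z.1 * g z.2) 2
      ((gaussianMeasure l Δt).prod (gaussianLaw Δt)) := by
    rw [memLp_two_iff_integrable_sq h1]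
    simp_rw [mul_pow]
    exact ((memLp_two_iff_integrable_sq hY.1).1 hY).mul_prod
      ((memLp_two_iff_integrable_sq hg.1).1 hg)
  exact h2.comp_measurePreserving (measurePreserving_splitAt l Δt)

/-- Independence of the increment at `l` from the earlier ones; every orthogonality relation below
rests on it. -/
theorem integral_comp_firstCoords_mul {N : ℕ} {Δt : ℝ} [Fact (0 < Δt)] (l : Fin N)
    {Y : (Fin l → ℝ) → ℝ} (hY : AEStronglyMeasurable Y (gaussianMeasure l Δt)) {g : ℝ → ℝ}
    (hg : AEStronglyMeasurable g (gaussianLaw Δt)) :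
    ∫ x : Fin N → ℝ, Y (firstCoords l.isLt.le x) * g (x l) ∂gaussianMeasure N Δt =
      (∫ y, Y y ∂gaussianMeasure l Δt) * ∫ t, g t ∂gaussianLaw Δt := by
  have hp := measurePreserving_splitAt l Δt
  rw [← integral_prod_mul, ← hp.map_eq, integral_map hp.measurable.aemeasurable]
  · rfl
  · rw [hp.map_eq]
    exact hY.comp_fst.mul hg.comp_snd

/-- The function `Y(ΔW_1, …, ΔW_{l-1}) H_m(ΔW_l / √Δt)`. -/
def chaosFun {N : ℕ} (Δt : ℝ) (m : ℕ) (l : Fin N) (Y : (Fin l → ℝ) → ℝ) (x : Fin N → ℝ) : ℝ :=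
  Y (firstCoords l.isLt.le x) * hermiteH m (x l / Real.sqrt Δt)

theorem memLp_chaosFun {N : ℕ} {Δt : ℝ} [Fact (0 < Δt)] (m : ℕ) (l : Fin N)
    {Y : (Fin l → ℝ) → ℝ} (hY : MemLp Y 2 (gaussianMeasure l Δt)) :
    MemLp (chaosFun Δt m l Y) 2 (gaussianMeasure N Δt) :=
  memLp_comp_firstCoords_mul l hY (g := fun t => hermiteH m (t / Real.sqrt Δt))
    (memLp_hermiteH_gaussianLaw Δt m)

theorem chaosFun_congr_ae {N : ℕ} {Δt : ℝ} [Fact (0 < Δt)] (m : ℕ) (l : Fin N)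
    {Y Z : (Fin l → ℝ) → ℝ} (h : Y =ᵐ[gaussianMeasure l Δt] Z) :
    chaosFun Δt m l Y =ᵐ[gaussianMeasure N Δt] chaosFun Δt m l Z := by
  filter_upwards [(measurePreserving_firstCoords l.isLt.le Δt).quasiMeasurePreserving.ae h]
    with x hx
  simp [chaosFun, hx]

theorem integral_chaosFun_mul {N : ℕ} {Δt : ℝ} [Fact (0 < Δt)] (m n : ℕ) (l : Fin N)
    {Y Z : (Fin l → ℝ) → ℝ} (hY : MemLp Y 2 (gaussianMeasure l Δt))
    (hZ : MemLp Z 2 (gaussianMeasure l Δt)) :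
    ∫ x, chaosFun Δt m l Y x * chaosFun Δt n l Z x ∂gaussianMeasure N Δt =
      (∫ y, Y y * Z y ∂gaussianMeasure l Δt) * if m = n then 1 else 0 := by
  rw [← integral_hermiteH_mul_gaussianLaw Δt m n]
  refine Eq.trans ?_ (integral_comp_firstCoords_mul l (hY.1.mul hZ.1)
    ((memLp_hermiteH_gaussianLaw Δt m).1.mul (memLp_hermiteH_gaussianLaw Δt n).1))
  refine integral_congr_ae (ae_of_all _ fun x => ?_)
  simp only [chaosFun, Pi.mul_apply]
  ring

/-- Everything except the last Hermite factor depends on coordinates before `l`, and that factor is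
independent of them with mean zero since `n ≠ 0`. -/
theorem integral_chaosFun_mul_of_lt {N : ℕ} {Δt : ℝ} [Fact (0 < Δt)] (m : ℕ) {n : ℕ} (hn : n ≠ 0)
    {k l : Fin N} (hkl : k < l) {Y : (Fin k → ℝ) → ℝ} (hY : MemLp Y 2 (gaussianMeasure k Δt))
    {Z : (Fin l → ℝ) → ℝ} (hZ : MemLp Z 2 (gaussianMeasure l Δt)) :
    ∫ x, chaosFun Δt m k Y x * chaosFun Δt n l Z x ∂gaussianMeasure N Δt = 0 := by
  -- The index `k` read in ℝ^l, so that the first chaos function becomes a function of the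
  -- coordinates before `l`.
  let k' : Fin l := ⟨k, hkl⟩
  have h := integral_comp_firstCoords_mul l
    ((memLp_chaosFun (Δt := Δt) m k' (Y := Y) hY).1.mul hZ.1)
    (memLp_hermiteH_gaussianLaw Δt n).1
  rw [integral_hermiteH_gaussianLaw Δt hn, mul_zero] at h
  rw [← h]
  refine integral_congr_ae (ae_of_all _ fun x => ?_)
  simp only [chaosFun, Pi.mul_apply, mul_assoc]
  rfl

theorem integral_chaosFun {N : ℕ} {Δt : ℝ} [Fact (0 < Δt)] {m : ℕ} (hm : m ≠ 0) (l : Fin N)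
    {Y : (Fin l → ℝ) → ℝ} (hY : MemLp Y 2 (gaussianMeasure l Δt)) :
    ∫ x, chaosFun Δt m l Y x ∂gaussianMeasure N Δt = 0 := by
  have h := integral_comp_firstCoords_mul l hY.1 (memLp_hermiteH_gaussianLaw Δt m).1
  rwa [integral_hermiteH_gaussianLaw Δt hm, mul_zero] at h

theorem inner_toLp {α : Type*} [MeasurableSpace α] {μ : Measure α} {f g : α → ℝ}
    (hf : MemLp f 2 μ) (hg : MemLp g 2 μ) :
    inner ℝ hf.toLp hg.toLp = ∫ x, f x * g x ∂μ := by
  rw [L2.inner_def]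
  refine integral_congr_ae ?_
  filter_upwards [hf.coeFn_toLp, hg.coeFn_toLp] with x h1 h2
  rw [h1, h2]
  simp [mul_comm]

/-- The isometry `Y ↦ Y(ΔW_1, …, ΔW_{l-1}) H_m(ΔW_l / √Δt)` from `L²(μ^{l-1})` to `L²(μ^N)`. -/
def chaosIsometry {N : ℕ} (Δt : ℝ) [Fact (0 < Δt)] (m : ℕ) (l : Fin N) :
    Lp ℝ 2 (gaussianMeasure l Δt) →ₗᵢ[ℝ] Lp ℝ 2 (gaussianMeasure N Δt) where
  toFun Y := (memLp_chaosFun m l (Lp.memLp Y)).toLp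
  map_add' Y Z := by
    rw [← MemLp.toLp_add]
    refine MemLp.toLp_congr _ _ ((chaosFun_congr_ae m l (Lp.coeFn_add Y Z)).trans
      (ae_of_all _ fun x => ?_))
    simp [chaosFun, add_mul]
  map_smul' c Y := by
    rw [RingHom.id_apply, ← MemLp.toLp_const_smul]
    refine MemLp.toLp_congr _ _ ((chaosFun_congr_ae m l (Lp.coeFn_smul c Y)).trans
      (ae_of_all _ fun x => ?_))
    simp [chaosFun, mul_assoc]
  norm_map' Y := by
    have hY := Lp.memLp Y
    have h := inner_toLp (memLp_chaosFun m l hY) (memLp_chaosFun m l hY)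
    rw [integral_chaosFun_mul m m l hY hY, if_pos rfl, mul_one, ← inner_toLp hY hY,
      Lp.toLp_coeFn, real_inner_self_eq_norm_sq, real_inner_self_eq_norm_sq] at h
    exact (pow_left_inj₀ (norm_nonneg _) (norm_nonneg _) two_ne_zero).1 h

theorem chaosIsometry_apply {N : ℕ} (Δt : ℝ) [Fact (0 < Δt)] (m : ℕ) (l : Fin N)
    (Y : Lp ℝ 2 (gaussianMeasure l Δt)) :
    chaosIsometry Δt m l Y = (memLp_chaosFun m l (Lp.memLp Y)).toLp := rfl

/-- The shift to `i.1 + 1` matters: in degree zero the functions need not have mean zero, and the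
ranges for different `l` overlap. -/
theorem orthogonalFamily_chaosIsometry (N : ℕ) (Δt : ℝ) [Fact (0 < Δt)] :
    OrthogonalFamily ℝ (fun i : ℕ × Fin N => Lp ℝ 2 (gaussianMeasure i.2 Δt))
      fun i => chaosIsometry Δt (i.1 + 1) i.2 := by
  rintro ⟨m, k⟩ ⟨n, l⟩ hne Y Z
  simp only [chaosIsometry_apply, inner_toLp]
  rcases lt_trichotomy k l with h | rfl | h
  · exact integral_chaosFun_mul_of_lt _ n.succ_ne_zero h (Lp.memLp Y) (Lp.memLp Z)
  · rw [integral_chaosFun_mul _ _ _ (Lp.memLp Y) (Lp.memLp Z), if_neg, mul_zero]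
    rintro h
    exact hne (by simpa using h)
  · simp_rw [mul_comm (chaosFun Δt (m + 1) k Y _)]
    exact integral_chaosFun_mul_of_lt _ m.succ_ne_zero h (Lp.memLp Z) (Lp.memLp Y)

/-! ### Totality of the chaos expansion -/

theorem linear_apply_eq_sum {n : ℕ} (L : (Fin n → ℝ) →L[ℝ] ℝ) (x : Fin n → ℝ) :
    L x = ∑ i, L (Pi.single i 1) * x i := by
  conv_lhs => rw [← Finset.univ_sum_single x, map_sum]
  refine Finset.sum_congr rfl fun i _ => ?_
  have : (Pi.single i (x i) : Fin n → ℝ) = x i • Pi.single i 1 := by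
    rw [← Pi.single_smul, smul_eq_mul, mul_one]
  rw [this, map_smul, smul_eq_mul, mul_comm]

theorem memLp_prod_pow (n : ℕ) (Δt : ℝ) [Fact (0 < Δt)] (a : Fin n → ℕ) :
    MemLp (fun x : Fin n → ℝ => ∏ i, x i ^ a i) 2 (gaussianMeasure n Δt) := by
  rw [memLp_two_iff_integrable_sq (Continuous.aestronglyMeasurable (by fun_prop)),
    gaussianMeasure_eq_pi]
  simp_rw [← Finset.prod_pow, ← pow_mul]
  refine Integrable.fintype_prod (f := fun i (t : ℝ) => t ^ (a i * 2)) fun i => ?_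
  exact (integrable_polynomial_gaussianReal (X ^ (a i * 2)) _).congr (ae_of_all _ fun t => by simp)

/-- Square integrability is what is needed, since the exponential will be integrated against a
density that is merely in L². -/
theorem memLp_exp_linear (n : ℕ) (Δt : ℝ) [Fact (0 < Δt)] (L : (Fin n → ℝ) →L[ℝ] ℝ) (t : ℝ) :
    MemLp (fun x => Real.exp (t * L x)) 2 (gaussianMeasure n Δt) := by
  classical
  rw [memLp_two_iff_integrable_sq (Continuous.aestronglyMeasurable (by fun_prop)),
    gaussianMeasure_eq_pi]
  have e : ∀ x : Fin n → ℝ, Real.exp (t * L x) ^ 2 =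
      ∏ i, Real.exp (2 * t * L (Pi.single i 1) * x i) := fun x => by
    rw [← Real.exp_sum, ← Real.exp_nat_mul]
    congr 1
    rw [linear_apply_eq_sum L x, Finset.mul_sum, Finset.mul_sum]
    exact Finset.sum_congr rfl fun i _ => by push_cast; ring
  simp_rw [e]
  exact Integrable.fintype_prod (f := fun i s => Real.exp (2 * t * L (Pi.single i 1) * s))
    fun i => integrable_exp_mul_gaussianReal _

/-- The rescaled Hermite polynomials `He_m(x / √Δt)`. -/
def scaledHermite (Δt : ℝ) [h : Fact (0 < Δt)] : Polynomial.Sequence ℝ where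
  elems' m := (realHermite m).comp (C (Real.sqrt Δt)⁻¹ * X)
  degree_eq' m := by
    have hc : (Real.sqrt Δt)⁻¹ ≠ 0 := inv_ne_zero (Real.sqrt_pos.2 h.out).ne'
    have hd : (C (Real.sqrt Δt)⁻¹ * X).natDegree = 1 := natDegree_C_mul_X _ hc
    have h0 : (realHermite m).comp (C (Real.sqrt Δt)⁻¹ * X) ≠ 0 := by
      intro h0
      rcases comp_eq_zero_iff.1 h0 with h1 | h1
      · exact (monic_realHermite m).ne_zero h1
      · rw [h1.2, natDegree_C] at hd
        exact zero_ne_one hd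
    rw [degree_eq_natDegree h0, natDegree_comp, hd, natDegree_realHermite, mul_one]

theorem eval_scaledHermite (Δt : ℝ) [Fact (0 < Δt)] (m : ℕ) (x : ℝ) :
    (scaledHermite Δt m).eval x =
      Real.sqrt (m.factorial : ℝ) * hermiteH m (x / Real.sqrt Δt) := by
  have : Real.sqrt (m.factorial : ℝ) ≠ 0 := (Real.sqrt_pos.2 (by positivity)).ne'
  rw [hermiteH_eq_eval, mul_div_cancel₀ _ this, scaledHermite]
  simp [div_eq_inv_mul]

theorem span_scaledHermite (Δt : ℝ) [Fact (0 < Δt)] :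
    Submodule.span ℝ (Set.range (scaledHermite Δt)) = ⊤ :=
  (scaledHermite Δt).span fun i =>
    (leadingCoeff_ne_zero.2 ((scaledHermite Δt).ne_zero i)).isUnit

section Totality

variable {N : ℕ} {Δt : ℝ} [Fact (0 < Δt)] {f : Lp ℝ 2 (gaussianMeasure N Δt)}

/-- The scaled Hermite polynomials, one in each degree, span all polynomials. Degree zero has to be
among the hypotheses for this. -/
theorem integral_mul_polynomial_eq_zero (l : Fin N) {Y : (Fin l → ℝ) → ℝ}
    (hY : MemLp Y 2 (gaussianMeasure l Δt))
    (h : ∀ m, ∫ x, f x * chaosFun Δt m l Y x ∂gaussianMeasure N Δt = 0) (q : ℝ[X]) :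
    ∫ x, f x * (Y (firstCoords l.isLt.le x) * q.eval (x l)) ∂gaussianMeasure N Δt = 0 := by
  have hint : ∀ q : ℝ[X], Integrable
      (fun x => f x * (Y (firstCoords l.isLt.le x) * q.eval (x l))) (gaussianMeasure N Δt) :=
    fun q => (Lp.memLp f).integrable_mul
      (memLp_comp_firstCoords_mul l hY (g := fun t => q.eval t)
        (memLp_polynomial_gaussianLaw Δt q))
  have hq : q ∈ Submodule.span ℝ (Set.range (scaledHermite Δt)) := by
    rw [span_scaledHermite]; trivial
  induction hq using Submodule.span_induction with
  | mem q hq =>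
    obtain ⟨m, rfl⟩ := hq
    rw [← mul_zero (Real.sqrt (m.factorial : ℝ)), ← h m, ← integral_const_mul]
    refine integral_congr_ae (ae_of_all _ fun x => ?_)
    simp only [eval_scaledHermite, chaosFun]
    ring
  | zero => simp
  | add p q _ _ hp hq =>
    simp only [eval_add, mul_add]
    rw [integral_add (hint p) (hint q), hp, hq, add_zero]
  | smul c q _ hq =>
    rw [← mul_zero c, ← hq, ← integral_const_mul]
    refine integral_congr_ae (ae_of_all _ fun x => ?_)
    simp only [eval_smul, smul_eq_mul]
    ring

/-- Induction on the number of coordinates: the power of the last one is expanded in Hermite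
polynomials. Positive degrees vanish by `h`, and degree zero leaves a monomial in fewer coordinates.
-/
theorem integral_mul_prod_pow_eq_zero (h0 : ∫ x, f x ∂gaussianMeasure N Δt = 0)
    (h : ∀ m (l : Fin N) (Y : (Fin l → ℝ) → ℝ), MemLp Y 2 (gaussianMeasure l Δt) →
      ∫ x, f x * chaosFun Δt (m + 1) l Y x ∂gaussianMeasure N Δt = 0)
    (k : ℕ) (hk : k ≤ N) (a : Fin k → ℕ) :
    ∫ x, f x * ∏ i, firstCoords hk x i ^ a i ∂gaussianMeasure N Δt = 0 := by
  induction k with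
  | zero => simpa using h0
  | succ k ih =>
    have hY := memLp_prod_pow k Δt fun i => a i.castSucc
    have key := integral_mul_polynomial_eq_zero (f := f) ⟨k, hk⟩ hY (fun m => ?_)
      (X ^ a (Fin.last k))
    · rw [← key]
      refine integral_congr_ae (ae_of_all _ fun x => ?_)
      simp only [Fin.prod_univ_castSucc, eval_pow, eval_X]
      rfl
    · cases m with
      | zero =>
        simp only [chaosFun, hermiteH_zero, mul_one]
        exact ih (Nat.le_of_succ_le hk) _
      | succ m => exact h m _ _ hY

theorem integral_mul_linear_pow_eq_zero (h0 : ∫ x, f x ∂gaussianMeasure N Δt = 0)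
    (h : ∀ m (l : Fin N) (Y : (Fin l → ℝ) → ℝ), MemLp Y 2 (gaussianMeasure l Δt) →
      ∫ x, f x * chaosFun Δt (m + 1) l Y x ∂gaussianMeasure N Δt = 0)
    (L : (Fin N → ℝ) →L[ℝ] ℝ) (n : ℕ) :
    ∫ x, f x * L x ^ n ∂gaussianMeasure N Δt = 0 := by
  classical
  have e : ∀ x, f x * L x ^ n = ∑ a ∈ Finset.univ.piAntidiag n,
      (Nat.multinomial Finset.univ a * ∏ i, L (Pi.single i 1) ^ a i) *
        (f x * ∏ i, x i ^ a i) := fun x => by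
    rw [linear_apply_eq_sum L x, Finset.sum_pow_eq_sum_piAntidiag, Finset.mul_sum]
    refine Finset.sum_congr rfl fun a _ => ?_
    simp_rw [mul_pow, Finset.prod_mul_distrib]
    ring
  simp_rw [e]
  have hint : ∀ a : Fin N → ℕ, Integrable (fun x => f x * ∏ i, x i ^ a i)
      (gaussianMeasure N Δt) := fun a => (Lp.memLp f).integrable_mul (memLp_prod_pow N Δt a)
  rw [integral_finsetSum _ fun a _ => (hint a).const_mul _]
  refine Finset.sum_eq_zero fun a _ => ?_
  rw [integral_const_mul]
  have := integral_mul_prod_pow_eq_zero h0 h N le_rfl a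
  simp only [firstCoords, Fin.castLE_rfl, id_eq] at this
  rw [this, mul_zero]

end Totality

/-- Random variables with all exponential moments are determined by their moments. -/
theorem complexMGF_eq_of_integral_pow_eq {Ω : Type*} [MeasurableSpace Ω] {Z : Ω → ℝ}
    {P Q : Measure Ω} (hP : ∀ t, Integrable (fun ω => Real.exp (t * Z ω)) P)
    (hQ : ∀ t, Integrable (fun ω => Real.exp (t * Z ω)) Q)
    (h : ∀ n : ℕ, ∫ ω, Z ω ^ n ∂P = ∫ ω, Z ω ^ n ∂Q) : complexMGF Z P = complexMGF Z Q := by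
  have hP' : integrableExpSet Z P = Set.univ := Set.eq_univ_of_forall hP
  have hQ' : integrableExpSet Z Q = Set.univ := Set.eq_univ_of_forall hQ
  have dP : Differentiable ℂ (complexMGF Z P) := fun z =>
    (analyticAt_complexMGF (by simp [hP'])).differentiableAt
  have dQ : Differentiable ℂ (complexMGF Z Q) := fun z =>
    (analyticAt_complexMGF (by simp [hQ'])).differentiableAt
  funext z
  -- Both transforms are entire, and their derivatives at 0 are the moments.
  rw [← Complex.taylorSeries_eq_of_entire' 0 z dP, ← Complex.taylorSeries_eq_of_entire' 0 z dQ]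
  congr 1
  funext n
  rw [iteratedDeriv_complexMGF (by simp [hP']), iteratedDeriv_complexMGF (by simp [hQ'])]
  have := congrArg (fun r : ℝ => (r : ℂ)) (h n)
  simp only [← integral_complex_ofReal] at this
  simp only [zero_mul, Complex.exp_zero, mul_one]
  push_cast at this
  rw [this]

theorem eq_zero_of_integral_linear_pow {N : ℕ} {Δt : ℝ} [Fact (0 < Δt)]
    {f : Lp ℝ 2 (gaussianMeasure N Δt)}
    (h : ∀ (L : (Fin N → ℝ) →L[ℝ] ℝ) (n : ℕ), ∫ x, f x * L x ^ n ∂gaussianMeasure N Δt = 0) :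
    f = 0 := by
  have hfm : Measurable f := (Lp.stronglyMeasurable f).measurable
  have hfi : Integrable f (gaussianMeasure N Δt) := (Lp.memLp f).integrable (by norm_num)
  let p : (Fin N → ℝ) → ℝ≥0 := fun x => (f x).toNNReal
  let q : (Fin N → ℝ) → ℝ≥0 := fun x => (-f x).toNNReal
  have hp : Measurable p := hfm.real_toNNReal
  have hq : Measurable q := hfm.neg.real_toNNReal
  have hpf : ∀ x, (p x : ℝ) - q x = f x := fun x => by
    simp only [p, q, Real.coe_toNNReal']
    rcases le_total 0 (f x) with h | h
    · rw [max_eq_left h, max_eq_right (by linarith)]; ring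
    · rw [max_eq_right h, max_eq_left (by linarith)]; ring
  have hpfin : ∫⁻ x, p x ∂gaussianMeasure N Δt ≠ ∞ := hfi.lintegral_lt_top.ne
  have hqfin : ∫⁻ x, q x ∂gaussianMeasure N Δt ≠ ∞ := hfi.neg.lintegral_lt_top.ne
  have hple : ∀ x, (p x : ℝ) ≤ |f x| := fun x => by
    simp only [p, Real.coe_toNNReal']; exact max_le (le_abs_self _) (abs_nonneg _)
  have hqle : ∀ x, (q x : ℝ) ≤ |f x| := fun x => by
    simp only [q, Real.coe_toNNReal']; exact max_le (neg_le_abs _) (abs_nonneg _)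
  -- The product of `|f|` and `g`, both in L², is an integrable majorant.
  have hdom : ∀ r : (Fin N → ℝ) → ℝ≥0, Measurable r → (∀ x, (r x : ℝ) ≤ |f x|) →
      ∀ g : (Fin N → ℝ) → ℝ, MemLp g 2 (gaussianMeasure N Δt) → Integrable (fun x => r x • g x) (gaussianMeasure N Δt) := by
    intro r hr hle g hg
    refine ((Lp.memLp f).integrable_mul hg).mono
      (hr.coe_nnreal_real.aestronglyMeasurable.mul hg.1) (ae_of_all _ fun x => ?_)
    simp only [NNReal.smul_def, smul_eq_mul, norm_mul, Pi.mul_apply, Real.norm_eq_abs,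
      NNReal.abs_eq]
    exact mul_le_mul_of_nonneg_right (hle x) (abs_nonneg _)
  let P := (gaussianMeasure N Δt).withDensity fun x => p x
  let Q := (gaussianMeasure N Δt).withDensity fun x => q x
  have hPfin : IsFiniteMeasure P := isFiniteMeasure_withDensity hpfin
  have hQfin : IsFiniteMeasure Q := isFiniteMeasure_withDensity hqfin
  have hexpP : ∀ (L : (Fin N → ℝ) →L[ℝ] ℝ) t, Integrable (fun x => Real.exp (t * L x)) P :=
    fun L t => (integrable_withDensity_iff_integrable_smul hp).2
      (hdom p hp hple _ (memLp_exp_linear N Δt L t))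
  have hexpQ : ∀ (L : (Fin N → ℝ) →L[ℝ] ℝ) t, Integrable (fun x => Real.exp (t * L x)) Q :=
    fun L t => (integrable_withDensity_iff_integrable_smul hq).2
      (hdom q hq hqle _ (memLp_exp_linear N Δt L t))
  have hmom : ∀ (L : (Fin N → ℝ) →L[ℝ] ℝ) (n : ℕ), ∫ x, L x ^ n ∂P = ∫ x, L x ^ n ∂Q := by
    intro L n
    have h0P : 0 ∈ interior (integrableExpSet L P) := by
      rw [show integrableExpSet L P = Set.univ from Set.eq_univ_of_forall (hexpP L)]; simp
    have h0Q : 0 ∈ interior (integrableExpSet L Q) := by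
      rw [show integrableExpSet L Q = Set.univ from Set.eq_univ_of_forall (hexpQ L)]; simp
    have iP := integrable_pow_of_mem_interior_integrableExpSet h0P n
    have iQ := integrable_pow_of_mem_interior_integrableExpSet h0Q n
    rw [integrable_withDensity_iff_integrable_smul hp] at iP
    rw [integrable_withDensity_iff_integrable_smul hq] at iQ
    rw [integral_withDensity_eq_integral_smul hp, integral_withDensity_eq_integral_smul hq,
      ← sub_eq_zero, ← integral_sub iP iQ, ← h L n]
    refine integral_congr_ae (ae_of_all _ fun x => ?_)
    simp only [NNReal.smul_def, smul_eq_mul, ← sub_mul, hpf]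
  -- The complex moment generating function of `L` at the imaginary unit is the characteristic
  -- function at `L`, and these determine a finite measure.
  have hPQ : P = Q := by
    refine Measure.ext_of_charFunDual (funext fun L => ?_)
    have := congrFun (complexMGF_eq_of_integral_pow_eq (hexpP L) (hexpQ L) (hmom L)) Complex.I
    simpa only [complexMGF, charFunDual_apply, mul_comm Complex.I] using this
  have hae := (withDensity_eq_iff hp.coe_nnreal_ennreal.aemeasurable
    hq.coe_nnreal_ennreal.aemeasurable hpfin).1 hPQ
  rw [Lp.eq_zero_iff_ae_eq_zero]
  filter_upwards [hae] with x hx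
  have hx' : p x = q x := ENNReal.coe_injective hx
  rw [← hpf x, hx', sub_self]
  rfl

theorem chaosIsometry_total {N : ℕ} {Δt : ℝ} [Fact (0 < Δt)] {f : Lp ℝ 2 (gaussianMeasure N Δt)}
    (h0 : ∫ x, f x ∂gaussianMeasure N Δt = 0)
    (h : ∀ m (l : Fin N) Y, inner ℝ (chaosIsometry Δt (m + 1) l Y) f = 0) : f = 0 := by
  refine eq_zero_of_integral_linear_pow (integral_mul_linear_pow_eq_zero h0 fun m l Y hY => ?_)
  rw [← h m l hY.toLp, chaosIsometry_apply,
    MemLp.toLp_congr _ (memLp_chaosFun (m + 1) l hY) (chaosFun_congr_ae _ l hY.coeFn_toLp)]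
  conv_rhs => rw [← Lp.toLp_coeFn f (Lp.memLp f), inner_toLp]
  simp_rw [mul_comm]

theorem hasSum_chaosIsometry (N : ℕ) (Δt : ℝ) [Fact (0 < Δt)]
    (f : Lp ℝ 2 (gaussianMeasure N Δt))
    (hf : MemLp (fun x => f x - ∫ y, f y ∂gaussianMeasure N Δt) 2 (gaussianMeasure N Δt)) :
    HasSum (fun m : ℕ => ∑ l : Fin N, chaosIsometry Δt (m + 1) l
      ((chaosIsometry Δt (m + 1) l).toContinuousLinearMap.adjoint f)) hf.toLp := by
  have h1 : MemLp (fun _ : Fin N → ℝ => (1 : ℝ)) 2 (gaussianMeasure N Δt) := memLp_const 1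
  have hinner : ∀ g : Lp ℝ 2 (gaussianMeasure N Δt),
      inner ℝ h1.toLp g = ∫ x, g x ∂gaussianMeasure N Δt := fun g => by
    conv_lhs => rw [← Lp.toLp_coeFn g (Lp.memLp g), inner_toLp]
    simp
  have hsum := hasSum_comp_adjoint (orthogonalFamily_chaosIsometry N Δt) (e := h1.toLp) ?_ ?_ ?_ f
  · have he : f - inner ℝ h1.toLp f • h1.toLp = hf.toLp := by
      rw [hinner]
      conv_lhs => rw [← Lp.toLp_coeFn f (Lp.memLp f), ← MemLp.toLp_const_smul, ← MemLp.toLp_sub]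
      refine MemLp.toLp_congr _ _ ?_
      rw [Lp.toLp_coeFn]
      exact ae_of_all _ fun x => by simp
    rw [he] at hsum
    -- The family over pairs `(m, l)` is summable, so it may be grouped into finite sums over `l`.
    exact hsum.prod_fiberwise fun m => hasSum_fintype _
  · have := inner_toLp h1 h1
    rw [real_inner_self_eq_norm_sq] at this
    exact (pow_eq_one_iff_of_nonneg (norm_nonneg _) two_ne_zero).1 (this.trans (by simp))
  · rintro ⟨m, l⟩ Y
    rw [chaosIsometry_apply, inner_toLp]
    simpa using integral_chaosFun m.succ_ne_zero l (Lp.memLp Y)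
  · intro g hg hgY
    exact chaosIsometry_total (by rwa [hinner] at hg) fun m l Y => hgY (m, l) Y

/-! ### Iterated derivatives against test functions `Z p^N` -/

theorem pair_iterate_deriv {n : ℕ} {Δt : ℝ} [Fact (0 < Δt)] (k : Fin n) (X : GenFunctional n Δt)
    (m : ℕ) (φ : testSpace n Δt) :
    ((GenFunctional.deriv k)^[m] X).pair φ = (-1) ^ m * X.pair ((testDeriv k)^[m] φ) := by
  induction m generalizing X with
  | zero => simp
  | succ m ih =>
    rw [Function.iterate_succ_apply, ih, Function.iterate_succ_apply']
    simp only [GenFunctional.deriv, LinearMap.neg_apply, LinearMap.comp_apply]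
    ring

theorem density_add_smul_single {n : ℕ} {Δt : ℝ} [h : Fact (0 < Δt)] (l : Fin n)
    (x : Fin n → ℝ) (t : ℝ) :
    density n Δt (x + t • Pi.single l 1) =
      density n Δt x * Real.exp (-(2 * x l * t + t ^ 2) / (2 * Δt)) := by
  have h0 := h.out
  have e : ∑ i, (x + t • (Pi.single l 1 : Fin n → ℝ)) i ^ 2 =
      ∑ i, x i ^ 2 + (2 * x l * t + t ^ 2) := by
    have : ∀ i, (x + t • (Pi.single l 1 : Fin n → ℝ)) i ^ 2 =
        x i ^ 2 + (Pi.single l (2 * x l * t + t ^ 2) : Fin n → ℝ) i := fun i => by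
      rcases eq_or_ne i l with rfl | hi
      · simp; ring
      · simp [hi]
    simp_rw [this, Finset.sum_add_distrib]
    simp
  rw [density, density, e, mul_assoc _ (Real.exp _), ← Real.exp_add]
  congr 2
  ring

/-- Along direction `l` the factor Z is constant, so each derivative only raises the Hermite degree
by one and contributes -1/√Δt. -/
theorem iterate_testDeriv_mulDensity {N : ℕ} {Δt : ℝ} [h : Fact (0 < Δt)] (l : Fin N)
    (Z : 𝓢(Fin l → ℝ, ℝ)) (m : ℕ) (x : Fin N → ℝ) :
    ((testDeriv l)^[m] (mulDensity (Δt := Δt) l.isLt.le Z)).1 x =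
      (-(Real.sqrt Δt)⁻¹) ^ m * (realHermite m).eval (x l / Real.sqrt Δt) *
        Z (firstCoords l.isLt.le x) * density N Δt x := by
  have h0 := h.out
  have hs := Real.sqrt_pos.2 h0
  induction m generalizing x with
  | zero => simp [realHermite_zero, mulDensity_apply]
  | succ m ih =>
    rw [Function.iterate_succ_apply']
    set φ := (testDeriv l)^[m] (mulDensity (Δt := Δt) l.isLt.le Z)
    have hline : ((testDeriv l φ).1 : 𝓢(Fin N → ℝ, ℝ)) x =
        lineDeriv ℝ φ.1 x (Pi.single l 1) := by
      change (∂_{(Pi.single l 1 : Fin N → ℝ)} φ.1) x = _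
      rw [lineDerivOp_apply_eq_fderiv, (φ.1.differentiableAt).lineDeriv_eq_fderiv]
    have hfun : (fun t : ℝ => φ.1 (x + t • Pi.single l 1)) = fun t =>
        (-(Real.sqrt Δt)⁻¹) ^ m * (realHermite m).eval ((x l + t) / Real.sqrt Δt) *
          Z (firstCoords l.isLt.le x) *
          (density N Δt x * Real.exp (-(2 * x l * t + t ^ 2) / (2 * Δt))) := by
      funext t
      have hfirst : firstCoords l.isLt.le (x + t • Pi.single l 1) = firstCoords l.isLt.le x := by
        funext i
        have : Fin.castLE l.isLt.le i ≠ l := (Fin.ne_of_lt (Fin.lt_def.2 i.isLt))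
        simp [firstCoords, this]
      rw [ih, hfirst, density_add_smul_single]
      simp
    have hd1 : HasDerivAt (fun t : ℝ => (x l + t) / Real.sqrt Δt) (Real.sqrt Δt)⁻¹ 0 := by
      simpa using ((hasDerivAt_id (0 : ℝ)).const_add (x l)).div_const (Real.sqrt Δt)
    have hd2 := ((realHermite m).hasDerivAt ((x l + 0) / Real.sqrt Δt)).comp (0 : ℝ) hd1
    have hd3 : HasDerivAt (fun t : ℝ => -(2 * x l * t + t ^ 2) / (2 * Δt)) (-(x l / Δt)) 0 := by
      refine ((((hasDerivAt_id (0 : ℝ)).const_mul (2 * x l)).add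
        ((hasDerivAt_id (0 : ℝ)).pow 2)).neg.div_const (2 * Δt)).congr_deriv ?_
      simp
      field_simp
    have hd := ((hd2.const_mul ((-(Real.sqrt Δt)⁻¹) ^ m)).mul_const
      (Z (firstCoords l.isLt.le x))).mul (hd3.exp.const_mul (density N Δt x))
    rw [hline, lineDeriv, hfun]
    refine (HasDerivAt.deriv hd).trans ?_
    rw [realHermite_succ, pow_succ]
    have hsq : Δt = Real.sqrt Δt * Real.sqrt Δt := (Real.mul_self_sqrt h0.le).symm
    have hdiv : x l / Δt = (Real.sqrt Δt)⁻¹ * (x l / Real.sqrt Δt) := by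
      conv_lhs => rw [hsq]
      field_simp
    rw [hdiv]
    simp
    ring

/-! ### Existence of the conditional expectation -/

theorem integral_gaussianMeasure {n : ℕ} {Δt : ℝ} [h : Fact (0 < Δt)] (g : (Fin n → ℝ) → ℝ) :
    ∫ x, g x ∂gaussianMeasure n Δt = ∫ x, g x * density n Δt x := by
  rw [gaussianMeasure, integral_withDensity_eq_integral_toReal_smul
    (continuous_density n Δt).measurable.ennreal_ofReal (by simp)]
  refine integral_congr_ae (ae_of_all _ fun x => ?_)
  simp [ENNReal.toReal_ofReal (density_pos n h.out x).le, mul_comm]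

theorem memLp_schwartz {n : ℕ} {Δt : ℝ} [Fact (0 < Δt)] (Z : 𝓢(Fin n → ℝ, ℝ)) :
    MemLp Z 2 (gaussianMeasure n Δt) :=
  MemLp.of_bound Z.continuous.aestronglyMeasurable _
    (ae_of_all _ fun x => SchwartzMap.norm_le_seminorm ℝ Z x)

/-- Makes the defining identity of the conditional expectation one between inner products in L²(μ),
where adjoints apply. -/
theorem pair_ofL2_mulDensity {n : ℕ} {Δt : ℝ} [Fact (0 < Δt)]
    (Y : Lp ℝ 2 (gaussianMeasure n Δt)) (Z : 𝓢(Fin n → ℝ, ℝ)) :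
    (GenFunctional.ofL2 Y).pair (mulDensity le_rfl Z) = inner ℝ (memLp_schwartz Z).toLp Y := by
  conv_rhs => rw [← Lp.toLp_coeFn Y (Lp.memLp Y), inner_toLp, integral_gaussianMeasure]
  change ∫ x, Y x * (mulDensity (Δt := Δt) le_rfl Z).1 x = _
  refine integral_congr_ae (ae_of_all _ fun x => ?_)
  simp only [mulDensity_apply]
  have : firstCoords le_rfl x = x := rfl
  rw [this]
  ring

/-- The coefficient `Δt^(m/2) / √(m!)` of the expansion. -/
def chaosCoeff (Δt : ℝ) (m : ℕ) : ℝ := Δt ^ ((m : ℝ) / 2) / Real.sqrt (m.factorial : ℝ)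

theorem chaosCoeff_pos (Δt : ℝ) [h : Fact (0 < Δt)] (m : ℕ) : 0 < chaosCoeff Δt m :=
  div_pos (Real.rpow_pos_of_pos h.out _) (Real.sqrt_pos.2 (by positivity))

theorem inv_chaosCoeff (Δt : ℝ) [h : Fact (0 < Δt)] (m : ℕ) :
    (chaosCoeff Δt m)⁻¹ = (Real.sqrt Δt)⁻¹ ^ m * Real.sqrt (m.factorial : ℝ) := by
  rw [chaosCoeff, inv_div, Real.sqrt_eq_rpow Δt, inv_pow, ← Real.rpow_natCast,
    ← Real.rpow_mul h.out.le, div_eq_inv_mul]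
  congr 3
  ring

/-- The conditional expectation of the `m`-th derivative in the direction `l`. -/
def chaosKernel {N : ℕ} {Δt : ℝ} [Fact (0 < Δt)] (X : Lp ℝ 2 (gaussianMeasure N Δt)) (m : ℕ)
    (l : Fin N) : Lp ℝ 2 (gaussianMeasure l Δt) :=
  (chaosCoeff Δt m)⁻¹ • (chaosIsometry Δt m l).toContinuousLinearMap.adjoint X

theorem isCondExp_chaosKernel {N : ℕ} {Δt : ℝ} [Fact (0 < Δt)]
    (X : Lp ℝ 2 (gaussianMeasure N Δt)) (m : ℕ) (l : Fin N) :
    IsCondExp l.isLt.le ((GenFunctional.deriv l)^[m] (GenFunctional.ofL2 X))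
      (GenFunctional.ofL2 (chaosKernel X m l)) := by
  intro Z
  have hZ := memLp_schwartz (Δt := Δt) Z
  rw [pair_ofL2_mulDensity, chaosKernel, inner_smul_right,
    ContinuousLinearMap.adjoint_inner_right]
  change _ = _ * inner ℝ (chaosIsometry Δt m l hZ.toLp) X
  rw [chaosIsometry_apply,
    MemLp.toLp_congr _ (memLp_chaosFun m l hZ) (chaosFun_congr_ae _ l hZ.coeFn_toLp)]
  conv_rhs => rw [← Lp.toLp_coeFn X (Lp.memLp X), inner_toLp, integral_gaussianMeasure]
  rw [pair_iterate_deriv]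
  change _ * (∫ x, X x * ((testDeriv l)^[m] (mulDensity (Δt := Δt) l.isLt.le Z)).1 x) = _
  rw [inv_chaosCoeff, ← integral_const_mul, ← integral_const_mul]
  refine integral_congr_ae (ae_of_all _ fun x => ?_)
  have hf : Real.sqrt (m.factorial : ℝ) ≠ 0 := (Real.sqrt_pos.2 (by positivity)).ne'
  simp only [iterate_testDeriv_mulDensity, chaosFun, hermiteH_eq_eval]
  -- The sign from moving m derivatives cancels the sign in the m-th derivative of the Gaussian.
  rw [neg_pow]
  have h1 : ((-1 : ℝ) ^ m) * (-1) ^ m = 1 := by rw [← mul_pow]; simp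
  field_simp
  linear_combination (X x * (Real.sqrt Δt)⁻¹ ^ m * (realHermite m).eval (x l / Real.sqrt Δt) *
    Z (firstCoords l.isLt.le x) * density N Δt x) * h1

open scoped ContDiff

/-! ### Compactly supported functions are dense in the Schwartz space -/

section Cutoff

variable {E : Type*} [NormedAddCommGroup E] [NormedSpace ℝ E] [FiniteDimensional ℝ E]

/-- A smooth cutoff function, equal to `1` on the unit ball. -/
def cutoff (E : Type*) [NormedAddCommGroup E] [NormedSpace ℝ E] [FiniteDimensional ℝ E] :
    ContDiffBump (0 : E) := ⟨1, 2, one_pos, one_lt_two⟩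

/-- The function vanishes on the open unit ball, and outside it ‖x‖ ≥ 1, so the factor ‖x‖ costs
nothing. After rescaling it supplies the decay in `tendsto_cutoffMul`. -/
theorem exists_bound_iteratedFDeriv_cutoff (i : ℕ) :
    ∃ B : ℝ, 0 ≤ B ∧ ∀ x : E, ‖iteratedFDeriv ℝ i (fun y => cutoff E y - 1) x‖ ≤ B * ‖x‖ := by
  obtain ⟨C, hC⟩ := (((cutoff E).hasCompactSupport.toSchwartzMap (cutoff E).contDiff)).decay' 0 i
  simp only [pow_zero, one_mul] at hC
  have hC0 : 0 ≤ C := (norm_nonneg _).trans (hC 0)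
  -- `C` bounds the derivative of the cutoff; the additional 1 covers the subtracted constant, which
  -- matters for `i = 0`.
  refine ⟨C + 1, by positivity, fun x => ?_⟩
  rcases lt_or_ge ‖x‖ 1 with hx | hx
  · have hev : (fun y => cutoff E y - 1) =ᶠ[nhds x] fun _ => (0 : ℝ) := by
      filter_upwards [Metric.isOpen_ball.mem_nhds (mem_ball_zero_iff.2 hx)] with y hy
      rw [(cutoff E).one_of_mem_closedBall (Metric.ball_subset_closedBall hy), sub_self]
    rw [(hev.iteratedFDeriv ℝ i).eq_of_nhds]
    have : iteratedFDeriv ℝ i (fun _ : E => (0 : ℝ)) x = 0 := by simp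
    rw [this, norm_zero]
    positivity
  · have h1 : ‖iteratedFDeriv ℝ i (fun _ : E => (1 : ℝ)) x‖ ≤ 1 := by
      rcases eq_or_ne i 0 with rfl | hi
      · simp
      · simp [iteratedFDeriv_const_of_ne hi]
    have h2 : iteratedFDeriv ℝ i (fun y => cutoff E y - 1) x =
        iteratedFDeriv ℝ i (cutoff E) x - iteratedFDeriv ℝ i (fun _ : E => (1 : ℝ)) x :=
      iteratedFDeriv_sub_apply (cutoff E).contDiffAt contDiffAt_const
    rw [h2]
    calc _ ≤ ‖iteratedFDeriv ℝ i (cutoff E) x‖ + ‖iteratedFDeriv ℝ i (fun _ : E => (1 : ℝ)) x‖ :=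
          norm_sub_le _ _
      _ ≤ C + 1 := add_le_add (hC x) h1
      _ ≤ (C + 1) * ‖x‖ := le_mul_of_one_le_right (by positivity) hx

theorem hasCompactSupport_cutoff_mul (n : ℕ) (f : E → ℝ) :
    HasCompactSupport fun x => cutoff E ((n + 1 : ℝ)⁻¹ • x) * f x :=
  ((cutoff E).hasCompactSupport.comp_smul (by positivity)).mul_right

theorem contDiff_cutoff_smul (n : ℕ) :
    ContDiff ℝ ∞ fun x => cutoff E ((n + 1 : ℝ)⁻¹ • x) :=
  (cutoff E).contDiff.comp (contDiff_const_smul _)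

/-- The product of a Schwartz function with a cutoff at scale `n + 1`. -/
def cutoffMul (n : ℕ) (f : 𝓢(E, ℝ)) : 𝓢(E, ℝ) :=
  (hasCompactSupport_cutoff_mul n f).toSchwartzMap ((contDiff_cutoff_smul n).mul (f.smooth ⊤))

theorem cutoffMul_apply (n : ℕ) (f : 𝓢(E, ℝ)) (x : E) :
    cutoffMul n f x = cutoff E ((n + 1 : ℝ)⁻¹ • x) * f x := rfl

theorem tendsto_cutoffMul (f : 𝓢(E, ℝ)) :
    Filter.Tendsto (fun n => cutoffMul n f) Filter.atTop (nhds f) := by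
  rw [(schwartz_withSeminorms ℝ E ℝ).tendsto_nhds]
  rintro ⟨k, m⟩ ε hε
  choose B hB0 hB using fun i => exists_bound_iteratedFDeriv_cutoff (E := E) i
  -- The Leibniz bound. The seminorms have weight `k + 1` because the estimate for the cutoff brings
  -- an additional ‖x‖.
  set C : ℝ := ∑ i ∈ Finset.range (m + 1),
    m.choose i * (B i * SchwartzMap.seminorm ℝ (k + 1) (m - i) f) with hC
  have hbound : ∀ n : ℕ, SchwartzMap.seminorm ℝ k m (cutoffMul n f - f) ≤ (n + 1 : ℝ)⁻¹ * C := by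
    intro n
    have hr0 : (0 : ℝ) ≤ (n + 1 : ℝ)⁻¹ := by positivity
    have hr1 : (n + 1 : ℝ)⁻¹ ≤ 1 := inv_le_one_of_one_le₀ (by linarith [n.cast_nonneg (α := ℝ)])
    have hC0 : 0 ≤ C := Finset.sum_nonneg fun i _ =>
      mul_nonneg (by positivity) (mul_nonneg (hB0 i) (apply_nonneg _ _))
    refine SchwartzMap.seminorm_le_bound ℝ k m _ (mul_nonneg hr0 hC0) fun x => ?_
    set r : ℝ := (n + 1 : ℝ)⁻¹
    have hfun : ((cutoffMul n f - f : 𝓢(E, ℝ)) : E → ℝ) =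
        fun y => (cutoff E (r • y) - 1) * f y := by
      funext y
      rw [sub_apply, cutoffMul_apply]
      ring
    have hsm : ContDiff ℝ ∞ fun y : E => cutoff E y - 1 := (cutoff E).contDiff.sub contDiff_const
    have hsr : ContDiff ℝ ∞ fun y : E => cutoff E (r • y) - 1 :=
      (contDiff_cutoff_smul n).sub contDiff_const
    have hder : ∀ i, ‖iteratedFDeriv ℝ i (fun y => cutoff E (r • y) - 1) x‖ ≤
        r * (B i * ‖x‖) := by
      intro i
      have := congrFun (iteratedFDeriv_comp_const_smul (𝕜 := ℝ) (i := i) r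
        (hsm.of_le (by exact_mod_cast le_top))) x
      rw [this, norm_smul, norm_pow, Real.norm_of_nonneg hr0]
      -- Bounding `r ^ i` by 1 suffices, even for `i = 0`: the decay comes from ‖r • x‖.
      calc r ^ i * ‖iteratedFDeriv ℝ i (fun y => cutoff E y - 1) (r • x)‖
          ≤ 1 * (B i * ‖r • x‖) :=
            mul_le_mul (pow_le_one₀ hr0 hr1) (hB i _) (norm_nonneg _) zero_le_one
        _ = r * (B i * ‖x‖) := by rw [norm_smul, Real.norm_of_nonneg hr0]; ring
    rw [hfun]
    calc ‖x‖ ^ k * ‖iteratedFDeriv ℝ m (fun y => (cutoff E (r • y) - 1) * f y) x‖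
        ≤ ‖x‖ ^ k * ∑ i ∈ Finset.range (m + 1), m.choose i *
            ‖iteratedFDeriv ℝ i (fun y => cutoff E (r • y) - 1) x‖ *
            ‖iteratedFDeriv ℝ (m - i) f x‖ := by
          gcongr
          exact norm_iteratedFDeriv_mul_le hsr (f.smooth ⊤) x (by exact_mod_cast le_top)
      _ = ∑ i ∈ Finset.range (m + 1), ‖x‖ ^ k * (m.choose i *
            ‖iteratedFDeriv ℝ i (fun y => cutoff E (r • y) - 1) x‖ *
            ‖iteratedFDeriv ℝ (m - i) f x‖) := Finset.mul_sum _ _ _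
      _ ≤ ∑ i ∈ Finset.range (m + 1), r *
            (m.choose i * (B i * SchwartzMap.seminorm ℝ (k + 1) (m - i) f)) := by
          refine Finset.sum_le_sum fun i _ => ?_
          calc _ ≤ ‖x‖ ^ k * (m.choose i * (r * (B i * ‖x‖)) *
                ‖iteratedFDeriv ℝ (m - i) f x‖) := by gcongr; exact hder i
            _ = r * (m.choose i * (B i * (‖x‖ ^ (k + 1) * ‖iteratedFDeriv ℝ (m - i) f x‖))) := by
                rw [pow_succ]; ring
            _ ≤ _ := by
                have := hB0 i
                gcongr
                exact SchwartzMap.le_seminorm ℝ _ _ f x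
      _ = r * C := by rw [hC, Finset.mul_sum]
  have hlim : Filter.Tendsto (fun n : ℕ => (n + 1 : ℝ)⁻¹ * C) Filter.atTop (nhds 0) := by
    simpa using (tendsto_inv_atTop_zero.comp
      (Filter.tendsto_atTop_add_const_right _ (1 : ℝ) tendsto_natCast_atTop_atTop)).mul_const C
  filter_upwards [hlim.eventually (gt_mem_nhds hε)] with n hn
  exact (hbound n).trans_lt hn

end Cutoff

/-! ### Uniqueness of the conditional expectation -/

/-- The functional is continuous in f = φ/√p, and Z p corresponds to f = Z √p. A general f/√p need
not be Schwartz, but it becomes so once f is cut off, and the cutoffs converge to f. -/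
theorem GenFunctional.ext_mulDensity {n : ℕ} {Δt : ℝ} [h : Fact (0 < Δt)]
    {V W : GenFunctional n Δt}
    (hVW : ∀ Z : 𝓢(Fin n → ℝ, ℝ), V.pair (mulDensity le_rfl Z) = W.pair (mulDensity le_rfl Z)) :
    V = W := by
  obtain ⟨U, hU⟩ := V.continuous_pair
  obtain ⟨U', hU'⟩ := W.continuous_pair
  have hpos : ∀ x, 0 < sqrtDensity n Δt x := fun x => by
    rw [sqrtDensity_apply]; exact Real.sqrt_pos.2 (density_pos n h.out x)
  have hcut : ∀ (f : 𝓢(Fin n → ℝ, ℝ)) j, U (cutoffMul j f) = U' (cutoffMul j f) := by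
    intro f j
    let Z : 𝓢(Fin n → ℝ, ℝ) :=
      (hasCompactSupport_cutoff_mul j fun x => f x * (sqrtDensity n Δt x)⁻¹).toSchwartzMap
        ((contDiff_cutoff_smul j).mul ((f.smooth ⊤).mul
          (((sqrtDensity n Δt).smooth ⊤).inv fun x => (hpos x).ne')))
    have hZ : ∀ x, (mulDensity (Δt := Δt) le_rfl Z).1 x =
        Real.sqrt (density n Δt x) * cutoffMul j f x := by
      intro x
      have e : Z (firstCoords le_rfl x) = cutoff (Fin n → ℝ) ((j + 1 : ℝ)⁻¹ • x) *
        (f x * (sqrtDensity n Δt x)⁻¹) := rfl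
      rw [mulDensity_apply, e, cutoffMul_apply, ← sqrtDensity_apply, ← sqrtDensity_mul_self]
      have := (hpos x).ne'
      field_simp
    rw [← hU _ _ hZ, ← hU' _ _ hZ, hVW]
  have hUU : ∀ f, U f = U' f := fun f =>
    tendsto_nhds_unique ((U.continuous.tendsto f).comp (tendsto_cutoffMul f))
      (((U'.continuous.tendsto f).comp (tendsto_cutoffMul f)).congr fun j => (hcut f j).symm)
  ext φ
  obtain ⟨f, hf⟩ := φ.2
  rw [hU φ f hf, hU' φ f hf, hUU]

theorem isCondExp_iff_eq_chaosKernel {N : ℕ} {Δt : ℝ} [Fact (0 < Δt)]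
    (X : Lp ℝ 2 (gaussianMeasure N Δt)) (m : ℕ) (l : Fin N) (V : GenFunctional l Δt) :
    IsCondExp l.isLt.le ((GenFunctional.deriv l)^[m] (GenFunctional.ofL2 X)) V ↔
      V = GenFunctional.ofL2 (chaosKernel X m l) := by
  refine ⟨fun hV => GenFunctional.ext_mulDensity fun Z => ?_, ?_⟩
  · rw [← hV Z, isCondExp_chaosKernel X m l Z]
  · rintro rfl
    exact isCondExp_chaosKernel X m l

/-! ### The summands as multiples of the chaos isometries -/

theorem summand_eq_smul_chaosFun {N : ℕ} (Δt : ℝ) (m : ℕ) (l : Fin N) (Y : (Fin l → ℝ) → ℝ) :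
    summand Δt m l Y = chaosCoeff Δt m • chaosFun Δt m l Y := by
  funext x
  simp only [summand, chaosFun, chaosCoeff, Pi.smul_apply, smul_eq_mul, mul_assoc]

theorem memLp_summand {N : ℕ} {Δt : ℝ} [Fact (0 < Δt)] (m : ℕ) (l : Fin N)
    (Y : Lp ℝ 2 (gaussianMeasure l Δt)) :
    MemLp (summand Δt m l Y) 2 (gaussianMeasure N Δt) := by
  rw [summand_eq_smul_chaosFun]
  exact (memLp_chaosFun m l (Lp.memLp Y)).const_smul _

theorem toLp_summand {N : ℕ} {Δt : ℝ} [Fact (0 < Δt)] (m : ℕ) (l : Fin N)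
    (Y : Lp ℝ 2 (gaussianMeasure l Δt)) :
    (memLp_summand m l Y).toLp = chaosCoeff Δt m • chaosIsometry Δt m l Y := by
  rw [chaosIsometry_apply, ← MemLp.toLp_const_smul]
  exact MemLp.toLp_congr _ _ (ae_of_all _ fun x => by rw [summand_eq_smul_chaosFun])

end DiscreteWiener

end

open DiscreteWiener
theorem theorem2p1 (N : ℕ) (Δt : ℝ) [Fact (0 < Δt)] (X : Lp ℝ 2 (gaussianMeasure N Δt)) :
    ∃ Y : (m : ℕ) → (l : Fin N) → Lp ℝ 2 (gaussianMeasure l Δt),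
      (∀ m ≥ 1, ∀ (l : Fin N) (V : GenFunctional l Δt),
        IsCondExp l.isLt.le ((GenFunctional.deriv l)^[m] (GenFunctional.ofL2 X)) V ↔
          V = GenFunctional.ofL2 (Y m l)) ∧
      ∃ (hX : MemLp (fun x => X x - ∫ y, X y ∂gaussianMeasure N Δt) 2 (gaussianMeasure N Δt))
        (hterm : ∀ m l, MemLp (summand Δt m l (Y m l)) 2 (gaussianMeasure N Δt)),
        HasSum (fun m : ℕ => ∑ l : Fin N, (hterm (m + 1) l).toLp) hX.toLp := by
  have hX : MemLp (fun x => X x - ∫ y, X y ∂gaussianMeasure N Δt) 2 (gaussianMeasure N Δt) :=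
    (Lp.memLp X).sub (memLp_const _)
  -- The kernel is also defined for `m = 0`, a value that the series, indexed by `m + 1`, never
  -- uses.
  refine ⟨chaosKernel X, fun m _ l V => isCondExp_iff_eq_chaosKernel X m l V, hX, fun m l => memLp_summand m l _, ?_⟩
  convert! hasSum_chaosIsometry N Δt X hX using 3 with m l
  -- The coefficient of the summand cancels the inverse built into the kernel.
  rw [toLp_summand, chaosKernel, map_smul, smul_smul,
    mul_inv_cancel₀ (chaosCoeff_pos Δt _).ne', one_smul]
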